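/- Let $K$ be a field, $S=K[t_1,\ldots,t_s]$, and let $\omega\in\mathbb{Z}^s$ be a vector with positive entries. Let $\mathcal{L}\subset\mathbb{Z}^s$ be a subgroup (lattice) which is homogeneous with respect to $\omega$, i.e. $\langle\omega,a\rangle=0$ for all $a\in\mathcal{L}$, and let $L=(\{t^{a^+}-t^{a^-}\mid a\in\mathcal{L}\})\subset S$ be its lattice ideal, where $a=a^+-a^-$ is the decomposition of $a$ into nonnegative vectors with disjoint supports. For a set $I\subset S$ let $V(I)\subset K^s$ denote its set of common zeros, and call an ideal a complete intersection if it can be generated by as many elements as its height. Grade $S$ by $\deg t_i=\omega_i$. Assume that $V(L,t_i)=\{0\}$ for all $i=1,\ldots,s$. Then $L$ is a complete intersection if and only if there are homogeneous binomials $h_1,\ldots,h_{s-1}$ in $L$ and vectors $a_1,\ldots,a_{s-1}\in\mathbb{Z}^s$ satisfying: (i) $\mathcal{L}$ is the subgroup of $\mathbb{Z}^s$ generated by $a_1,\ldots,a_{s-1}$; (ii) $V(h_1,\ldots,h_{s-1},t_i)=\{0\}$ for all $i=1,\ldots,s$; (iii) $h_j=t^{a_j^+}-t^{a_j^-}$ for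 $j=1,\ldots,s-1$. Moreover, any $h_1,\ldots,h_{s-1}$ in $L$ that are homogeneous and satisfy (i)–(iii) for some such $a_1,\ldots,a_{s-1}$ generate $L$. -/

import Mathlib

open MvPolynomial

namespace LatticeIdeal

/-- The exponent vector `a⁺` of nonnegative parts of an integer vector `a`, as a monomial exponent.
The negative part `a⁻` is `posExp (-a)`. -/
noncomputable def posExp {s : ℕ} (a : Fin s → ℤ) : Fin s →₀ ℕ :=
  Finsupp.equivFunOnFinite.symm fun i => (a i).toNat

/-- The binomial `t^{a⁺} - t^{a⁻}` of an integer vector `a`. -/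
noncomputable def binomial (K : Type*) [Field K] {s : ℕ} (a : Fin s → ℤ) :
    MvPolynomial (Fin s) K :=
  monomial (posExp a) 1 - monomial (posExp (-a)) 1

/-- The lattice ideal `I(𝓛)`, generated by all `t^{a⁺} - t^{a⁻}` with `a ∈ 𝓛`. -/
noncomputable def latticeIdeal (K : Type*) [Field K] {s : ℕ} (𝓛 : AddSubgroup (Fin s → ℤ)) :
    Ideal (MvPolynomial (Fin s) K) :=
  Ideal.span {f | ∃ a ∈ 𝓛, f = binomial K a}

/-- A lattice is homogeneous with respect to `ω` if `ω` has positive entries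
and `⟨ω, a⟩ = 0` for all `a` in the lattice. -/
def IsHomogeneousLattice {s : ℕ} (ω : Fin s → ℕ) (𝓛 : AddSubgroup (Fin s → ℤ)) : Prop :=
  (∀ i, 0 < ω i) ∧ ∀ a ∈ 𝓛, ∑ i, (ω i : ℤ) * a i = 0

/-- An ideal is a complete intersection if it is generated by `r` elements, `r` its height. -/
def IsCompleteIntersection {R : Type*} [CommRing R] (I : Ideal R) : Prop :=
  ∃ (r : ℕ) (g : Fin r → R), I.height = r ∧ I = Ideal.span (Set.range g)

/-- `h_1, …, h_{s-1}` are homogeneous binomials in the lattice ideal of `𝓛`, of the form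
`h_j = t^{a_j⁺} - t^{a_j⁻}`, whose exponent vectors `a_j` generate `𝓛`, and
`V(h_1, …, h_{s-1}, t_i) = {0}` for all `i`. -/
structure IsAdmissible {K : Type*} [Field K] {s : ℕ} (ω : Fin s → ℕ)
    (𝓛 : AddSubgroup (Fin s → ℤ)) (h : Fin (s - 1) → MvPolynomial (Fin s) K)
    (a : Fin (s - 1) → Fin s → ℤ) : Prop where
  mem : ∀ j, h j ∈ latticeIdeal K 𝓛
  homogeneous : ∀ j, ∃ d : ℕ, IsWeightedHomogeneous ω (h j) d
  eq_binomial : ∀ j, h j = binomial K (a j)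
  closure_eq : AddSubgroup.closure (Set.range a) = 𝓛
  zeroLocus_eq : ∀ i, zeroLocus K (Ideal.span (Set.range h ∪ {X i})) = ({0} : Set (Fin s → K))

end LatticeIdeal

/-!
Throughout, `S = K[t_1, …, t_s]` is graded by `deg t_i = ω_i`, and the hypothesis on zeros is only
used at points with coordinates in `{0, 1}`, where a monomial has value `1` or `0` according to
whether its support lies in the set of nonzero coordinates
(`exists_support_of_zeroLocus_eq`). This makes the size of the field irrelevant.

**Admissible binomials generate `L`.** The point is that every variable is a nonzerodivisor modulo
`I = (h_1, …, h_{s-1})` (`mem_of_mul_X_mem`); then `I` contains, with the binomials of generators of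
the lattice, all of `L` (`latticeIdeal_closure_le`). Instead of invoking that `S` is
Cohen–Macaulay, the proof compares Hilbert series as functions of a real `z ∈ (0, 1)`. From
`0 → S/(J : f) → S/J → S/(J + f) → 0` (`hilbertSeries_eq_add`), adding a generator of degree `d`
multiplies the series by at least `1 - z ^ d`, which bounds the series of `S/I` below by
`∏ (1 - z ^ d_j) / ∏ (1 - z ^ ω_k)`. The same sequence gives Bézout's inequality
`dim S/(I + t_i) ≤ ω_i ∏ d_j / ∏ ω_k` for binomials (`hilbertSeries_binomials_le`): modulo some of
the variables one of the binomials becomes a monomial, and a monomial can be split into its factors.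
If `t_i` annihilated a nonzero element of `S/I`, the two bounds would contradict each other in the
limit `z → 1`.

**The height of `L` is `s - 1`** (`height_latticeIdeal`). The kernel of `t_k ↦ x ^ ω_k` bounds it
above. For the lower bound, the hypothesis on zeros forces the lattice to have finite index in the
integral points of `ω^⊥` (`exists_nsmul_mem`), so that `L` contains binomials
`t_j ^ E_j - t_i ^ E_i`; going down along the integral map `t_k ↦ t_k ^ E_k` reduces to primes that
contain all `t_j - t_i` (`le_height_latticeIdeal`).

**Complete intersections are generated by admissible binomials.** If `L` is generated by `s - 1`
elements, graded Nakayama selects `s - 1` generators among its binomials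
(`exists_generators_mem`), and their exponent vectors generate the lattice because the group algebra
of `ℤ^s` modulo a sublattice detects membership in the sublattice (`closure_eq_of_span_eq`).
-/

namespace LatticeIdeal

/-! ### Weighted homogeneous ideals -/

section Graded

variable {K : Type*} [Field K] {σ : Type*} {ω : σ → ℕ}

/-- An ideal is homogeneous for the grading `deg t_i = ω i` if it contains the homogeneous
components of its elements. -/
def IsGradedIdeal (ω : σ → ℕ) (I : Ideal (MvPolynomial σ K)) : Prop :=
  ∀ p ∈ I, ∀ n, weightedHomogeneousComponent ω n p ∈ I

lemma isGradedIdeal_span {G : Set (MvPolynomial σ K)}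
    (hG : ∀ g ∈ G, ∃ d, IsWeightedHomogeneous ω g d) : IsGradedIdeal ω (Ideal.span G) := by
  classical
  let _ := weightedGradedAlgebra K ω
  intro p hp n
  refine weightedHomogeneousComponent_mem_of_mem K ω ?_ hp n
  exact Ideal.homogeneous_span _ _ fun g hg => hG g hg

lemma weightedHomogeneousComponent_mul_of_le {f : MvPolynomial σ K} {d : ℕ}
    (hf : IsWeightedHomogeneous ω f d) (g : MvPolynomial σ K) {n : ℕ} (h : d ≤ n) :
    weightedHomogeneousComponent ω n (f * g) = f * weightedHomogeneousComponent ω (n - d) g := by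
  classical
  let _ := weightedGradedAlgebra K ω
  have := DirectSum.coe_decompose_mul_of_left_mem_of_le (weightedHomogeneousSubmodule K ω)
    (a := f) (b := g) hf h
  simp only [← weightedDecomposition.decompose'_apply]
  exact this

lemma weightedHomogeneousComponent_mul_of_lt {f : MvPolynomial σ K} {d : ℕ}
    (hf : IsWeightedHomogeneous ω f d) (g : MvPolynomial σ K) {n : ℕ} (h : n < d) :
    weightedHomogeneousComponent ω n (f * g) = 0 := by
  classical
  let _ := weightedGradedAlgebra K ω
  have := DirectSum.coe_decompose_mul_of_left_mem_of_not_le (weightedHomogeneousSubmodule K ω)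
    (a := f) (b := g) hf (not_le.2 h)
  simp only [← weightedDecomposition.decompose'_apply]
  exact this

end Graded

/-! ### Hilbert functions and Hilbert series -/

section Hilbert

variable {K : Type*} [Field K] {σ : Type*} {ω : σ → ℕ}

/-- The `K`-space of elements of degree `n` of an ideal. -/
noncomputable def degreePart (ω : σ → ℕ) (I : Ideal (MvPolynomial σ K)) (n : ℕ) :
    Submodule K (MvPolynomial σ K) :=
  I.restrictScalars K ⊓ weightedHomogeneousSubmodule K ω n

lemma mem_degreePart {I : Ideal (MvPolynomial σ K)} {n : ℕ} {p : MvPolynomial σ K} :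
    p ∈ degreePart ω I n ↔ p ∈ I ∧ IsWeightedHomogeneous ω p n := by
  simp [degreePart, mem_weightedHomogeneousSubmodule]

lemma degreePart_mono {I J : Ideal (MvPolynomial σ K)} (h : I ≤ J) (n : ℕ) :
    degreePart ω I n ≤ degreePart ω J n :=
  fun _ hp => ⟨h hp.1, hp.2⟩

/-- The Hilbert function of the quotient by `I`: the dimension of its part of degree `n`, written
as the codimension of the degree `n` part of `I`. The subtraction does not truncate for positive
weights, see `finrank_degreePart_le`. -/
noncomputable def hilbertFun (ω : σ → ℕ) (I : Ideal (MvPolynomial σ K)) (n : ℕ) : ℕ :=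
  Module.finrank K (weightedHomogeneousSubmodule K ω n) - Module.finrank K (degreePart ω I n)

/-- The value at the real number `z` of the Hilbert series of the quotient by `I`. -/
noncomputable def hilbertSeries (ω : σ → ℕ) (I : Ideal (MvPolynomial σ K)) (z : ℝ) : ℝ :=
  ∑' n, (hilbertFun ω I n : ℝ) * z ^ n

lemma hilbertFun_of_lt_degree {I : Ideal (MvPolynomial σ K)}
    (hI : IsGradedIdeal ω I) {f : MvPolynomial σ K} {d : ℕ} (hf : IsWeightedHomogeneous ω f d)
    {n : ℕ} (hn : n < d) :
    hilbertFun ω I n = hilbertFun ω (I ⊔ Ideal.span {f}) n := by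
  have : degreePart ω I n = degreePart ω (I ⊔ Ideal.span {f}) n := by
    refine le_antisymm (degreePart_mono le_sup_left n) fun p hp => ?_
    obtain ⟨hp, hpn⟩ := mem_degreePart.1 hp
    obtain ⟨a, ha, b, hb, rfl⟩ := Submodule.mem_sup.1 hp
    obtain ⟨c, rfl⟩ := Ideal.mem_span_singleton'.1 hb
    refine mem_degreePart.2 ⟨?_, hpn⟩
    have e := weightedHomogeneousComponent_eq_self hpn
    rw [map_add, mul_comm c f, weightedHomogeneousComponent_mul_of_lt hf _ hn, add_zero] at e
    rw [mul_comm c f, ← e]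
    exact hI _ ha _
  unfold hilbertFun
  rw [this]

lemma hilbertSeries_nonneg (I : Ideal (MvPolynomial σ K)) {z : ℝ} (h0 : 0 < z) :
    0 ≤ hilbertSeries ω I z :=
  tsum_nonneg fun n => by positivity

variable [Fintype σ]

lemma finite_weightedHomogeneousSubmodule (hω : ∀ i, 0 < ω i) (n : ℕ) :
    Module.Finite K (weightedHomogeneousSubmodule K ω n) :=
  Module.Finite.iff_fg.2 (weightedHomogeneousSubmodule_fg K ω (fun i => (hω i).ne') n)

lemma finite_degreePart (hω : ∀ i, 0 < ω i) (I : Ideal (MvPolynomial σ K)) (n : ℕ) :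
    Module.Finite K (degreePart ω I n) := by
  have := finite_weightedHomogeneousSubmodule (K := K) hω n
  exact Submodule.finiteDimensional_of_le (inf_le_right : degreePart ω I n ≤ _)

lemma finrank_degreePart_le (hω : ∀ i, 0 < ω i) (I : Ideal (MvPolynomial σ K)) (n : ℕ) :
    Module.finrank K (degreePart ω I n) ≤
      Module.finrank K (weightedHomogeneousSubmodule K ω n) := by
  have := finite_weightedHomogeneousSubmodule (K := K) hω n
  exact Submodule.finrank_mono inf_le_right

lemma hilbertFun_anti (hω : ∀ i, 0 < ω i) {I J : Ideal (MvPolynomial σ K)} (h : I ≤ J) (n : ℕ) :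
    hilbertFun ω J n ≤ hilbertFun ω I n := by
  have := finite_degreePart hω J n
  exact Nat.sub_le_sub_left (Submodule.finrank_mono (degreePart_mono h n)) _

lemma hilbertFun_lt (hω : ∀ i, 0 < ω i) {I J : Ideal (MvPolynomial σ K)} (h : I ≤ J) {n : ℕ}
    {p : MvPolynomial σ K} (hp : IsWeightedHomogeneous ω p n) (hI : p ∉ I) (hJ : p ∈ J) :
    hilbertFun ω J n + 1 ≤ hilbertFun ω I n := by
  have := finite_degreePart hω J n
  have h1 : degreePart ω I n < degreePart ω J n := by
    refine lt_of_le_of_ne (degreePart_mono h n) fun he => hI ?_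
    have : p ∈ degreePart ω J n := mem_degreePart.2 ⟨hJ, hp⟩
    exact (mem_degreePart.1 (he ▸ this)).1
  have h2 := Submodule.finrank_lt_finrank_of_lt h1
  have h3 := finrank_degreePart_le hω J n
  unfold hilbertFun
  omega

/-- Exactness of `0 → S/(I : f) → S/I → S/(I + f) → 0` in degree `n + d`, for `f` homogeneous of
degree `d`. -/
lemma hilbertFun_add_degree (hω : ∀ i, 0 < ω i) {I : Ideal (MvPolynomial σ K)}
    (hI : IsGradedIdeal ω I) {f : MvPolynomial σ K} {d : ℕ} (hf : IsWeightedHomogeneous ω f d)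
    (n : ℕ) :
    hilbertFun ω I (n + d) =
      hilbertFun ω (I ⊔ Ideal.span {f}) (n + d) + hilbertFun ω (I.colon {f}) n := by
  rcases eq_or_ne f 0 with rfl | hf0
  · have : degreePart ω (I.colon {0}) n = weightedHomogeneousSubmodule K ω n := by
      ext p
      simp [mem_degreePart, Submodule.mem_colon_singleton, mem_weightedHomogeneousSubmodule]
    rw [Ideal.span_singleton_zero, sup_bot_eq, hilbertFun, hilbertFun, this, Nat.sub_self, add_zero]
  have hfin := finite_degreePart hω I (n + d)
  have hfinn := finite_weightedHomogeneousSubmodule (K := K) hω n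
  set F := LinearMap.mulLeft K f with hF
  have hinj : Function.Injective F := fun a b h => mul_left_cancel₀ hf0 (by simpa [hF] using h)
  set W := (weightedHomogeneousSubmodule K ω n).map F with hW
  have hsup : degreePart ω (I ⊔ Ideal.span {f}) (n + d) = degreePart ω I (n + d) ⊔ W := by
    ext p
    constructor
    · intro hp
      obtain ⟨hp, hpn⟩ := mem_degreePart.1 hp
      obtain ⟨a, ha, b, hb, rfl⟩ := Submodule.mem_sup.1 hp
      obtain ⟨c, rfl⟩ := Ideal.mem_span_singleton'.1 hb
      have e := weightedHomogeneousComponent_eq_self hpn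
      rw [map_add, mul_comm c f,
        weightedHomogeneousComponent_mul_of_le hf _ (Nat.le_add_left d n)] at e
      rw [mul_comm c f, ← e, Nat.add_sub_cancel]
      refine Submodule.add_mem_sup (mem_degreePart.2 ⟨hI _ ha _,
        weightedHomogeneousComponent_isWeightedHomogeneous _ _⟩) ?_
      exact Submodule.mem_map_of_mem (weightedHomogeneousComponent_mem ω _ _)
    · intro hp
      obtain ⟨a, ha, b, hb, rfl⟩ := Submodule.mem_sup.1 hp
      obtain ⟨c, hc, rfl⟩ := Submodule.mem_map.1 hb
      obtain ⟨ha1, ha2⟩ := mem_degreePart.1 ha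
      refine mem_degreePart.2 ⟨add_mem (Ideal.mem_sup_left ha1) (Ideal.mem_sup_right ?_), ?_⟩
      · exact Ideal.mul_mem_right _ _ (Ideal.mem_span_singleton_self f)
      · refine ha2.add ?_
        rw [add_comm n d]
        exact hf.mul hc
  have hinf : degreePart ω I (n + d) ⊓ W = (degreePart ω (I.colon {f}) n).map F := by
    ext p
    constructor
    · rintro ⟨hp, hpW⟩
      obtain ⟨c, hc, rfl⟩ := Submodule.mem_map.1 hpW
      refine Submodule.mem_map_of_mem (mem_degreePart.2 ⟨?_, hc⟩)
      rw [Submodule.mem_colon_singleton, smul_eq_mul, mul_comm]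
      exact (mem_degreePart.1 hp).1
    · intro hp
      obtain ⟨c, hc, rfl⟩ := Submodule.mem_map.1 hp
      obtain ⟨hc1, hc2⟩ := mem_degreePart.1 hc
      refine ⟨mem_degreePart.2 ⟨?_, ?_⟩, Submodule.mem_map_of_mem hc2⟩
      · rw [Submodule.mem_colon_singleton, smul_eq_mul, mul_comm] at hc1
        exact hc1
      · rw [add_comm n d]
        exact hf.mul hc2
  have hdim := Submodule.finrank_sup_add_finrank_inf_eq (degreePart ω I (n + d)) W
  rw [← hsup, hinf, hW, ← (Submodule.equivMapOfInjective F hinj _).finrank_eq,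
    ← (Submodule.equivMapOfInjective F hinj _).finrank_eq] at hdim
  have h1 := finrank_degreePart_le hω I (n + d)
  have h2 := finrank_degreePart_le hω (I ⊔ Ideal.span {f}) (n + d)
  have h3 := finrank_degreePart_le hω (I.colon {f}) n
  unfold hilbertFun
  omega

lemma finrank_weightedHomogeneousSubmodule_le (hω : ∀ i, 0 < ω i) (n : ℕ) :
    Module.finrank K (weightedHomogeneousSubmodule K ω n) ≤ (n + 1) ^ Fintype.card σ := by
  classical
  have hfin := (Finsupp.finite_of_nat_weight_eq ω (fun i => (hω i).ne') n)
  have := hfin.to_subtype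
  have e : weightedHomogeneousSubmodule K ω n =
      restrictSupport K {d : σ →₀ ℕ | Finsupp.weight ω d = n} :=
    weightedHomogeneousSubmodule_eq_finsupp_supported K ω n
  rw [e, Module.finrank_eq_nat_card_basis (basisRestrictSupport K _)]
  have hle : ∀ d : {d : σ →₀ ℕ | Finsupp.weight ω d = n}, ∀ i, d.1 i < n + 1 := fun d i =>
    Nat.lt_succ_of_le ((Finsupp.le_weight ω (hω i).ne' d.1).trans d.2.le)
  let φ : {d : σ →₀ ℕ | Finsupp.weight ω d = n} → σ → Fin (n + 1) := fun d i => ⟨d.1 i, hle d i⟩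
  have hφ : Function.Injective φ := by
    intro a b h
    ext i
    simpa [φ] using congrArg Fin.val (congrFun h i)
  refine (Nat.card_le_card_of_injective φ hφ).trans ?_
  rw [Nat.card_eq_fintype_card, Fintype.card_fun, Fintype.card_fin]

lemma summable_hilbertSeries (hω : ∀ i, 0 < ω i) (I : Ideal (MvPolynomial σ K)) {z : ℝ}
    (h0 : 0 < z) (h1 : z < 1) : Summable fun n => (hilbertFun ω I n : ℝ) * z ^ n := by
  have h2 : Summable fun n : ℕ => ((n + 1 : ℕ) : ℝ) ^ Fintype.card σ * z ^ (n + 1) :=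
    (summable_nat_add_iff 1).2 (summable_pow_mul_geometric_of_norm_lt_one (Fintype.card σ)
      (r := z) (by rwa [Real.norm_of_nonneg h0.le]))
  refine Summable.of_nonneg_of_le (fun n => by positivity) (fun n => ?_) (h2.mul_left z⁻¹)
  have : (hilbertFun ω I n : ℝ) ≤ ((n + 1 : ℕ) : ℝ) ^ Fintype.card σ := by
    exact_mod_cast (Nat.sub_le _ _).trans (finrank_weightedHomogeneousSubmodule_le hω n)
  calc (hilbertFun ω I n : ℝ) * z ^ n ≤ ((n + 1 : ℕ) : ℝ) ^ Fintype.card σ * z ^ n := by gcongr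
    _ = _ := by rw [pow_succ]; field_simp

lemma hilbertSeries_anti (hω : ∀ i, 0 < ω i) {I J : Ideal (MvPolynomial σ K)} (h : I ≤ J) {z : ℝ}
    (h0 : 0 < z) (h1 : z < 1) : hilbertSeries ω J z ≤ hilbertSeries ω I z := by
  refine (summable_hilbertSeries hω J h0 h1).tsum_le_tsum (fun n => ?_)
    (summable_hilbertSeries hω I h0 h1)
  have := hilbertFun_anti hω h n
  gcongr

lemma hilbertSeries_add_pow_le (hω : ∀ i, 0 < ω i) {I J : Ideal (MvPolynomial σ K)} (h : I ≤ J)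
    {z : ℝ} (h0 : 0 < z) (h1 : z < 1) {m : ℕ}
    {p : MvPolynomial σ K} (hp : IsWeightedHomogeneous ω p m) (hI : p ∉ I) (hJ : p ∈ J) :
    hilbertSeries ω J z + z ^ m ≤ hilbertSeries ω I z := by
  classical
  have hs := hasSum_ite_eq m (z ^ m)
  have hJs := summable_hilbertSeries hω J h0 h1
  unfold hilbertSeries
  rw [← hs.tsum_eq, ← hJs.tsum_add hs.summable]
  refine (hJs.add hs.summable).tsum_le_tsum (fun n => ?_) (summable_hilbertSeries hω I h0 h1)
  split_ifs with hn
  · subst hn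
    have : (hilbertFun ω J n : ℝ) + 1 ≤ hilbertFun ω I n := by
      exact_mod_cast hilbertFun_lt hω h hp hI hJ
    nlinarith [pow_pos h0 n]
  · have := hilbertFun_anti hω h n
    rw [add_zero]
    gcongr

/-- Additivity of Hilbert series on `0 → S/(I : f) → S/I → S/(I + f) → 0`. -/
lemma hilbertSeries_eq_add (hω : ∀ i, 0 < ω i) {I : Ideal (MvPolynomial σ K)}
    (hI : IsGradedIdeal ω I) {f : MvPolynomial σ K} {d : ℕ} (hf : IsWeightedHomogeneous ω f d)
    {z : ℝ} (h0 : 0 < z) (h1 : z < 1) :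
    hilbertSeries ω I z =
      hilbertSeries ω (I ⊔ Ideal.span {f}) z + z ^ d * hilbertSeries ω (I.colon {f}) z := by
  have hs := summable_hilbertSeries hω I h0 h1
  have hs' := summable_hilbertSeries hω (I ⊔ Ideal.span {f}) h0 h1
  have hc := summable_hilbertSeries hω (I.colon {f}) h0 h1
  unfold hilbertSeries
  rw [← hs.sum_add_tsum_nat_add d, ← hs'.sum_add_tsum_nat_add d, ← tsum_mul_left, add_assoc,
    ← ((summable_nat_add_iff d).2 hs').tsum_add (hc.mul_left _)]
  congr 1
  · refine Finset.sum_congr rfl fun n hn => ?_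
    rw [hilbertFun_of_lt_degree hI hf (Finset.mem_range.1 hn)]
  · refine tsum_congr fun n => ?_
    rw [hilbertFun_add_degree hω hI hf n]
    push_cast
    ring

end Hilbert

/-! ### Bounds for Hilbert series of binomial ideals -/

section Series

variable {K : Type*} [Field K] {σ : Type*} {ω : σ → ℕ}

lemma isGradedIdeal_sup {I J : Ideal (MvPolynomial σ K)} (hI : IsGradedIdeal ω I)
    (hJ : IsGradedIdeal ω J) : IsGradedIdeal ω (I ⊔ J) := by
  intro p hp n
  obtain ⟨a, ha, b, hb, rfl⟩ := Submodule.mem_sup.1 hp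
  rw [map_add]
  exact Submodule.add_mem_sup (hI a ha n) (hJ b hb n)

lemma isGradedIdeal_span_singleton {f : MvPolynomial σ K} {d : ℕ}
    (hf : IsWeightedHomogeneous ω f d) : IsGradedIdeal ω (Ideal.span {f}) :=
  isGradedIdeal_span (by simpa using ⟨d, hf⟩)

lemma isGradedIdeal_span_X (T : Set σ) :
    IsGradedIdeal ω (Ideal.span (X '' T : Set (MvPolynomial σ K))) := by
  refine isGradedIdeal_span ?_
  rintro _ ⟨i, -, rfl⟩
  exact ⟨ω i, isWeightedHomogeneous_X K ω i⟩

lemma colon_span_X {T : Set σ} {k : σ} (hk : k ∉ T) :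
    (Ideal.span (X '' T : Set (MvPolynomial σ K))).colon {X k} = Ideal.span (X '' T) := by
  classical
  refine le_antisymm (fun p hp => ?_) (fun p hp => ?_)
  · rw [Submodule.mem_colon_singleton, smul_eq_mul, mem_ideal_span_X_image] at hp
    rw [mem_ideal_span_X_image]
    intro m hm
    obtain ⟨i, hi, h⟩ := hp (m + Finsupp.single k 1) (by
      rw [mem_support_iff, coeff_mul_X]
      exact mem_support_iff.1 hm)
    refine ⟨i, hi, ?_⟩
    have : k ≠ i := fun e => hk (e ▸ hi)
    simpa [Finsupp.single_apply, this] using h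
  · rw [Submodule.mem_colon_singleton, smul_eq_mul]
    exact Ideal.mul_mem_right _ _ hp

lemma hilbertSeries_top (z : ℝ) :
    hilbertSeries ω (⊤ : Ideal (MvPolynomial σ K)) z = 0 := by
  have : ∀ n, degreePart ω (⊤ : Ideal (MvPolynomial σ K)) n =
      weightedHomogeneousSubmodule K ω n := fun n =>
    le_antisymm inf_le_right fun p hp => mem_degreePart.2 ⟨trivial, hp⟩
  have : ∀ n, hilbertFun ω (⊤ : Ideal (MvPolynomial σ K)) n = 0 := fun n => by
    rw [hilbertFun, this, Nat.sub_self]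
  simp [hilbertSeries, this]

variable [Fintype σ]

lemma hilbertSeries_span_range_X (hω : ∀ i, 0 < ω i) (z : ℝ) :
    hilbertSeries ω (Ideal.span (X '' Set.univ : Set (MvPolynomial σ K))) z = 1 := by
  classical
  have hzero : weightedHomogeneousSubmodule K ω 0 = Submodule.span K {(1 : MvPolynomial σ K)} := by
    refine le_antisymm (fun p hp => ?_) ?_
    · rw [Submodule.mem_span_singleton]
      refine ⟨coeff 0 p, ?_⟩
      ext m
      rw [coeff_smul, coeff_one]
      split_ifs with hm
      · simp [← hm]
      · by_contra hne
        have h0 : coeff m p ≠ 0 := fun h => hne (by simp [h])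
        have := hp h0
        refine hm (Finsupp.ext fun i => ?_)
        have := (Finsupp.le_weight ω (hω i).ne' m).trans this.le
        simp at this ⊢
        exact this.symm
    · rw [Submodule.span_singleton_le_iff_mem]
      exact isWeightedHomogeneous_one K ω
  have hfun : ∀ n, hilbertFun ω (Ideal.span (X '' Set.univ : Set (MvPolynomial σ K))) n =
      if n = 0 then 1 else 0 := by
    intro n
    split_ifs with hn
    · subst hn
      have h1 : degreePart ω (Ideal.span (X '' Set.univ : Set (MvPolynomial σ K))) 0 = ⊥ := by
        rw [eq_bot_iff]
        intro p hp
        obtain ⟨hp, hp0⟩ := mem_degreePart.1 hp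
        rw [Submodule.mem_bot]
        ext m
        rw [coeff_zero]
        by_contra hne
        obtain ⟨i, -, hi⟩ := mem_ideal_span_X_image.1 hp m (mem_support_iff.2 hne)
        have := (Finsupp.le_weight ω (hω i).ne' m).trans (hp0 hne).le
        omega
      rw [hilbertFun, h1, hzero, finrank_span_singleton one_ne_zero, finrank_bot]
    · have h1 : degreePart ω (Ideal.span (X '' Set.univ : Set (MvPolynomial σ K))) n =
          weightedHomogeneousSubmodule K ω n := by
        refine le_antisymm inf_le_right fun p hp => mem_degreePart.2 ⟨?_, hp⟩
        rw [mem_ideal_span_X_image]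
        intro m hm
        by_contra! hcon
        have hm0 : m = 0 := Finsupp.ext fun i => hcon i trivial
        have := hp (mem_support_iff.1 hm)
        simp [hm0] at this
        exact hn this.symm
      rw [hilbertFun, h1, Nat.sub_self]
  rw [hilbertSeries, tsum_eq_single 0 fun n hn => by rw [hfun, if_neg hn]; simp, hfun]
  simp

/-- The Hilbert series of a polynomial ring in the variables outside `T`. -/
lemma hilbertSeries_span_X [DecidableEq σ] (hω : ∀ i, 0 < ω i) {z : ℝ} (h0 : 0 < z) (h1 : z < 1)
    (T : Finset σ) :
    hilbertSeries ω (Ideal.span (X '' (T : Set σ) : Set (MvPolynomial σ K))) z *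
      ∏ k ∈ Tᶜ, (1 - z ^ ω k) = 1 := by
  induction h : Tᶜ using Finset.induction_on generalizing T with
  | empty =>
    rw [Finset.compl_eq_empty_iff] at h
    subst h
    simp [hilbertSeries_span_range_X hω, -Set.image_univ]
  | insert k U hk ih =>
    have hkT : k ∉ T := by
      rw [← Finset.mem_compl, h]
      exact Finset.mem_insert_self k U
    have h2 := ih (insert k T) (by
      rw [Finset.compl_insert, h, Finset.erase_insert hk])
    have h3 := hilbertSeries_eq_add hω (isGradedIdeal_span_X (K := K) (T : Set σ))
      (isWeightedHomogeneous_X K ω k) h0 h1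
    rw [colon_span_X (by simpa using hkT), ← Ideal.span_union] at h3
    rw [Finset.coe_insert, Set.image_insert_eq, ← Set.union_singleton] at h2
    rw [Finset.prod_insert hk, ← mul_assoc]
    refine Eq.trans ?_ h2
    congr 1
    linarith

/-- Adding a homogeneous generator of degree `d` to an ideal multiplies the Hilbert series by at
least `1 - z ^ d`. -/
lemma prod_mul_hilbertSeries_le {ι : Type*} [DecidableEq ι] (hω : ∀ i, 0 < ω i) {z : ℝ}
    (h0 : 0 < z) (h1 : z < 1) (h : ι → MvPolynomial σ K) (d : ι → ℕ)
    (hh : ∀ j, IsWeightedHomogeneous ω (h j) (d j)) (J : Finset ι) :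
    (∏ j ∈ J, (1 - z ^ d j)) * hilbertSeries ω (⊥ : Ideal (MvPolynomial σ K)) z ≤
      hilbertSeries ω (Ideal.span (h '' (J : Set ι))) z := by
  induction J using Finset.induction_on with
  | empty => simp
  | insert j J hj ih =>
    have hI : IsGradedIdeal ω (Ideal.span (h '' (J : Set ι))) :=
      isGradedIdeal_span (by rintro _ ⟨j, -, rfl⟩; exact ⟨d j, hh j⟩)
    have h2 := hilbertSeries_eq_add hω hI (hh j) h0 h1
    have h3 := hilbertSeries_anti hω (I := Ideal.span (h '' (J : Set ι)))
      (J := (Ideal.span (h '' (J : Set ι))).colon {h j})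
      (fun p hp => by
        rw [Submodule.mem_colon_singleton, smul_eq_mul]
        exact Ideal.mul_mem_right _ _ hp) h0 h1
    rw [← Ideal.span_union] at h2
    rw [Finset.coe_insert, Set.image_insert_eq, ← Set.union_singleton, Finset.prod_insert hj,
      mul_assoc]
    have hz : z ^ d j ≤ 1 := pow_le_one₀ h0.le h1.le
    have hz0 : 0 < z ^ d j := by positivity
    nlinarith [mul_le_mul_of_nonneg_left ih (sub_nonneg.2 hz),
      mul_le_mul_of_nonneg_left h3 hz0.le]

lemma hilbertSeries_sup_span_mul_le (hω : ∀ i, 0 < ω i) {z : ℝ} (h0 : 0 < z) (h1 : z < 1)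
    {I : Ideal (MvPolynomial σ K)} (hI : IsGradedIdeal ω I) {f g : MvPolynomial σ K} {d e : ℕ}
    (hf : IsWeightedHomogeneous ω f d) (hg : IsWeightedHomogeneous ω g e) :
    hilbertSeries ω (I ⊔ Ideal.span {f * g}) z ≤
      hilbertSeries ω (I ⊔ Ideal.span {f}) z + hilbertSeries ω (I ⊔ Ideal.span {g}) z := by
  have hfg := isGradedIdeal_sup hI (isGradedIdeal_span_singleton (hf.mul hg))
  rw [hilbertSeries_eq_add hω hfg hg h0 h1, add_comm]
  refine add_le_add ?_ (hilbertSeries_anti hω (sup_le_sup_right le_sup_left _) h0 h1)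
  refine (mul_le_of_le_one_left (hilbertSeries_nonneg _ h0) (pow_le_one₀ h0.le h1.le)).trans ?_
  refine hilbertSeries_anti hω (sup_le (fun p hp => ?_) ?_) h0 h1
  · rw [Submodule.mem_colon_singleton, smul_eq_mul]
    exact Ideal.mem_sup_left (Ideal.mul_mem_right _ _ hp)
  · rw [Ideal.span_singleton_le_iff_mem, Submodule.mem_colon_singleton, smul_eq_mul]
    exact Ideal.mem_sup_right (Ideal.mem_span_singleton_self _)

lemma hilbertSeries_sup_span_monomial_le (hω : ∀ i, 0 < ω i) {z : ℝ} (h0 : 0 < z) (h1 : z < 1)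
    {I : Ideal (MvPolynomial σ K)} (hI : IsGradedIdeal ω I) (u : σ →₀ ℕ) :
    hilbertSeries ω (I ⊔ Ideal.span {monomial u 1}) z ≤
      ∑ k, (u k : ℝ) * hilbertSeries ω (I ⊔ Ideal.span {X k}) z := by
  classical
  have hzero : hilbertSeries ω (I ⊔ Ideal.span {(monomial (0 : σ →₀ ℕ) 1 : MvPolynomial σ K)}) z
      = 0 := by
    have : (monomial (0 : σ →₀ ℕ) 1 : MvPolynomial σ K) = 1 := rfl
    rw [this, Ideal.span_singleton_one, sup_top_eq, hilbertSeries_top]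
  have hadd : ∀ u v : σ →₀ ℕ,
      hilbertSeries ω (I ⊔ Ideal.span {(monomial (u + v) 1 : MvPolynomial σ K)}) z ≤
        hilbertSeries ω (I ⊔ Ideal.span {monomial u 1}) z +
        hilbertSeries ω (I ⊔ Ideal.span {monomial v 1}) z := by
    intro u v
    have := hilbertSeries_sup_span_mul_le hω h0 h1 hI
      (isWeightedHomogeneous_monomial ω u (1 : K) rfl)
      (isWeightedHomogeneous_monomial ω v (1 : K) rfl)
    rwa [monomial_mul, one_mul] at this
  induction u using Finsupp.induction_linear with
  | zero => simp [hilbertSeries_top]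
  | add u v hu hv =>
    refine (hadd u v).trans ((add_le_add hu hv).trans_eq ?_)
    rw [← Finset.sum_add_distrib]
    refine Finset.sum_congr rfl fun k _ => ?_
    simp only [Finsupp.add_apply, Nat.cast_add]
    ring
  | single a b =>
    have : ∀ b : ℕ,
        hilbertSeries ω (I ⊔ Ideal.span {(monomial (Finsupp.single a b) 1 : MvPolynomial σ K)}) z
          ≤ b * hilbertSeries ω (I ⊔ Ideal.span {X a}) z := by
      intro b
      induction b with
      | zero => simp [hilbertSeries_top]
      | succ b ih =>
        rw [Finsupp.single_add]
        refine (hadd _ _).trans ?_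
        push_cast
        rw [add_mul, one_mul]
        exact add_le_add ih le_rfl
    refine (this b).trans_eq ?_
    rw [Finset.sum_eq_single a] <;> simp +contextual [eq_comm]

/-- Bézout's bound for binomials: let `|J|` homogeneous binomials together with the
`|σ| - |J|` variables in `Z` have only the trivial common zero. Then the quotient has dimension at
most `∏ deg h_j / ∏ ω_k`, the products over `J` and over the variables outside `Z`.

The condition on zeros is the one for points with coordinates in `{0, 1}`, where `A` is the set of
nonzero coordinates. For the point with `A = Zᶜ` it says that modulo the variables in `Z` some
binomial becomes a monomial, which is then split into its variables. -/
lemma hilbertSeries_binomials_le {ι : Type*} [DecidableEq ι] [DecidableEq σ]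
    (hω : ∀ i, 0 < ω i) {z : ℝ} (h0 : 0 < z) (h1 : z < 1) (u v : ι → σ →₀ ℕ)
    (huv : ∀ j, Finsupp.weight ω (u j) = Finsupp.weight ω (v j))
    (J : Finset ι) (Z : Finset σ) (hcard : J.card + Z.card = Fintype.card σ)
    (hA : ∀ A : Finset σ, A.Nonempty → Disjoint A Z →
      ∃ j ∈ J, ¬ ((u j).support ⊆ A ↔ (v j).support ⊆ A)) :
    hilbertSeries ω (Ideal.span ((fun j => (monomial (u j) 1 - monomial (v j) 1 :
      MvPolynomial σ K)) '' (J : Set ι)) ⊔ Ideal.span (X '' (Z : Set σ))) z *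
        ∏ k ∈ Zᶜ, (ω k : ℝ) ≤ ∏ j ∈ J, (Finsupp.weight ω (u j) : ℝ) := by
  set h : ι → MvPolynomial σ K := fun j => monomial (u j) 1 - monomial (v j) 1 with hh
  have hhom : ∀ j, IsWeightedHomogeneous ω (h j) (Finsupp.weight ω (u j)) := fun j =>
    (isWeightedHomogeneous_monomial ω (u j) (1 : K) rfl).sub
      (isWeightedHomogeneous_monomial ω (v j) (1 : K) (huv j).symm)
  induction hn : J.card generalizing J Z with
  | zero =>
    rw [Finset.card_eq_zero] at hn
    subst hn
    have hZ : Z = Finset.univ := by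
      rw [← Finset.card_eq_iff_eq_univ]
      simpa using hcard
    subst hZ
    have := hilbertSeries_span_range_X (K := K) hω z
    simp only [Finset.coe_empty, Set.image_empty, Ideal.span_empty, bot_sup_eq, Finset.coe_univ,
      this, Finset.compl_univ, Finset.prod_empty, mul_one, le_refl]
  | succ n ih =>
    have hB : (Zᶜ).Nonempty := by
      rw [← Finset.card_pos, Finset.card_compl]
      omega
    obtain ⟨j, hj, hex⟩ := hA Zᶜ hB disjoint_compl_left
    -- One of the two monomials avoids `Z`, the other one does not.
    obtain ⟨p, hpw, hpB, hpmem, hpA⟩ : ∃ p : σ →₀ ℕ,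
        Finsupp.weight ω p = Finsupp.weight ω (u j) ∧ p.support ⊆ Zᶜ ∧
        (monomial p 1 : MvPolynomial σ K) ∈
          Ideal.span (h '' (J : Set ι)) ⊔ Ideal.span (X '' (Z : Set σ)) ∧
        ∀ A, Disjoint A Z → ¬ p.support ⊆ A → ((u j).support ⊆ A ↔ (v j).support ⊆ A) := by
      have hjmem : h j ∈ Ideal.span (h '' (J : Set ι)) ⊔ Ideal.span (X '' (Z : Set σ)) :=
        Ideal.mem_sup_left (Ideal.subset_span ⟨j, hj, rfl⟩)
      have hmono : ∀ q : σ →₀ ℕ, ¬ q.support ⊆ Zᶜ → (monomial q 1 : MvPolynomial σ K) ∈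
          Ideal.span (h '' (J : Set ι)) ⊔ Ideal.span (X '' (Z : Set σ)) := by
        intro q hq
        refine Ideal.mem_sup_right (mem_ideal_span_X_image.2 fun m hm => ?_)
        have : m = q := by
          by_contra hne
          simp [coeff_monomial, Ne.symm hne] at hm
        subst this
        obtain ⟨i, hi, hiZ⟩ := Finset.not_subset.1 hq
        exact ⟨i, by simpa using hiZ, Finsupp.mem_support_iff.1 hi⟩
      have hnot : ∀ q : σ →₀ ℕ, ¬ q.support ⊆ Zᶜ → ∀ A, Disjoint A Z → ¬ q.support ⊆ A :=
        fun q hq A hAZ hqA => hq (hqA.trans (Finset.subset_compl_iff_disjoint_right.2 hAZ))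
      by_cases hu : (u j).support ⊆ Zᶜ
      · have hv : ¬ (v j).support ⊆ Zᶜ := fun hv => hex (iff_of_true hu hv)
        refine ⟨u j, rfl, hu, ?_, fun A hAZ hn => iff_of_false hn (hnot _ hv A hAZ)⟩
        have := add_mem hjmem (hmono _ hv)
        rwa [hh, sub_add_cancel] at this
      · have hv : (v j).support ⊆ Zᶜ := by
          by_contra hv
          exact hex (iff_of_false hu hv)
        refine ⟨v j, (huv j).symm, hv, ?_, fun A hAZ hn => iff_of_false (hnot _ hu A hAZ) hn⟩
        have := sub_mem (hmono _ hu) hjmem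
        rwa [hh, sub_sub_cancel] at this
    set I' := Ideal.span (h '' ((J.erase j : Finset ι) : Set ι)) ⊔ Ideal.span (X '' (Z : Set σ))
      with hI'
    have hgr : IsGradedIdeal ω I' :=
      isGradedIdeal_sup (isGradedIdeal_span (by rintro _ ⟨j, -, rfl⟩; exact ⟨_, hhom j⟩))
        (isGradedIdeal_span_X _)
    have hle : I' ⊔ Ideal.span {monomial p 1} ≤
        Ideal.span (h '' (J : Set ι)) ⊔ Ideal.span (X '' (Z : Set σ)) := by
      refine sup_le (sup_le_sup_right (Ideal.span_mono (Set.image_mono ?_)) _) ?_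
      · exact_mod_cast Finset.erase_subset j J
      · rwa [Ideal.span_singleton_le_iff_mem]
    have hstep : ∀ k, (p k : ℝ) * hilbertSeries ω (I' ⊔ Ideal.span {X k}) z * ∏ k ∈ Zᶜ, (ω k : ℝ) ≤
        (p k * ω k : ℝ) * ∏ j ∈ J.erase j, (Finsupp.weight ω (u j) : ℝ) := by
      intro k
      rcases eq_or_ne (p k) 0 with hk | hk
      · simp [hk]
      have hkp : k ∈ p.support := Finsupp.mem_support_iff.2 hk
      have hkZ : k ∉ Z := Finset.mem_compl.1 (hpB hkp)
      have := ih (J.erase j) (insert k Z)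
        (by rw [Finset.card_erase_of_mem hj, Finset.card_insert_of_notMem hkZ]; omega)
        (by
          intro A hAne hAZ
          rw [Finset.disjoint_insert_right] at hAZ
          obtain ⟨j', hj', hne⟩ := hA A hAne hAZ.2
          refine ⟨j', Finset.mem_erase.2 ⟨?_, hj'⟩, hne⟩
          rintro rfl
          exact hne (hpA A hAZ.2 fun hs => hAZ.1 (hs hkp)))
        (by rw [Finset.card_erase_of_mem hj, hn, Nat.add_sub_cancel])
      rw [Finset.coe_insert, Set.image_insert_eq, Ideal.span_insert, sup_comm (Ideal.span {X k}),
        ← sup_assoc, ← hI', Finset.compl_insert] at this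
      rw [← Finset.mul_prod_erase _ _ (Finset.mem_compl.2 hkZ)]
      calc _ = (p k * ω k : ℝ) * (hilbertSeries ω (I' ⊔ Ideal.span {X k}) z *
            ∏ k ∈ Zᶜ.erase k, (ω k : ℝ)) := by ring
        _ ≤ _ := mul_le_mul_of_nonneg_left this (by positivity)
    calc _ ≤ hilbertSeries ω (I' ⊔ Ideal.span {monomial p 1}) z * ∏ k ∈ Zᶜ, (ω k : ℝ) :=
          mul_le_mul_of_nonneg_right (hilbertSeries_anti hω hle h0 h1) (by positivity)
      _ ≤ (∑ k, (p k : ℝ) * hilbertSeries ω (I' ⊔ Ideal.span {X k}) z) * ∏ k ∈ Zᶜ, (ω k : ℝ) :=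
          mul_le_mul_of_nonneg_right (hilbertSeries_sup_span_monomial_le hω h0 h1 hgr p)
            (by positivity)
      _ ≤ ∑ k, (p k * ω k : ℝ) * ∏ j ∈ J.erase j, (Finsupp.weight ω (u j) : ℝ) := by
          rw [Finset.sum_mul]
          exact Finset.sum_le_sum fun k _ => hstep k
      _ = _ := by
          rw [← Finset.sum_mul, ← Finset.mul_prod_erase _ _ hj, ← hpw]
          congr 1
          rw [Finsupp.weight_apply, Finsupp.sum_fintype _ _ (by simp)]
          push_cast [smul_eq_mul]
          rfl

end Series

/-! ### Variables are nonzerodivisors modulo the binomials -/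

section Regular

variable {K : Type*} [Field K] {σ : Type*} [Fintype σ] {ω : σ → ℕ}
  {ι : Type*} [Fintype ι]

open Filter Topology in
/-- The inequality of rational functions that survives division by `(1 - z) ^ |σ|` and passage to
the limit `z → 1`. -/
lemma prod_mul_le_of_forall_lt_one (hcard : Fintype.card ι + 1 = Fintype.card σ) (d : ι → ℕ)
    (i : σ) (c : ℝ) (M : ℕ)
    (h : ∀ z : ℝ, 0 < z → z < 1 → (∏ j, (1 - z ^ d j)) * (1 - z ^ ω i) * c ≤
      ((∏ j, (d j : ℝ)) - z ^ M * c) * ∏ k, (1 - z ^ ω k)) :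
    (∏ j, (d j : ℝ)) * ω i * c ≤ ((∏ j, (d j : ℝ)) - c) * ∏ k, (ω k : ℝ) := by
  set g : ℕ → ℝ → ℝ := fun n z => ∑ l ∈ Finset.range n, z ^ l with hg
  have hgc : ∀ n, Continuous (g n) := fun n => by fun_prop
  have hg1 : ∀ n, g n 1 = n := fun n => by simp [hg]
  have hgz : ∀ n z, 1 - z ^ n = (1 - z) * g n z := fun n z => (mul_neg_geom_sum z n).symm
  have hlim : ∀ f : ℝ → ℝ, Continuous f → Tendsto f (𝓝[<] 1) (𝓝 (f 1)) := fun f hf =>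
    hf.continuousAt.tendsto.mono_left nhdsWithin_le_nhds
  have hl := hlim (fun z => (∏ j, g (d j) z) * g (ω i) z * c) (by fun_prop)
  have hr := hlim (fun z => ((∏ j, (d j : ℝ)) - z ^ M * c) * ∏ k, g (ω k) z) (by fun_prop)
  have := le_of_tendsto_of_tendsto hl hr (by
    filter_upwards [Ioo_mem_nhdsLT (zero_lt_one' ℝ)] with z hz
    have hz' : 0 < (1 - z) ^ Fintype.card σ := pow_pos (sub_pos.2 hz.2) _
    have := h z hz.1 hz.2
    simp only [hgz, Finset.prod_mul_distrib, Finset.prod_const, Finset.card_univ] at this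
    refine le_of_mul_le_mul_left ?_ hz'
    calc _ = (1 - z) ^ Fintype.card ι * (∏ j, g (d j) z) * ((1 - z) * g (ω i) z) * c := by
          rw [← hcard]; ring
      _ ≤ _ := this
      _ = _ := by ring)
  simpa [hg1] using this

/-- A system of homogeneous binomials, one fewer than the variables, which together with `t_i` has
only the trivial zero: then `t_i` is a nonzerodivisor modulo the binomials. The Hilbert series of
the quotient is bounded below by counting relations and above by Bézout's bound; the two bounds
agree to leading order at `z = 1`, which leaves no room for an element annihilated by `t_i`. -/
lemma mem_of_mul_X_mem (hω : ∀ i, 0 < ω i) (hcard : Fintype.card ι + 1 = Fintype.card σ)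
    (u v : ι → σ →₀ ℕ) (huv : ∀ j, Finsupp.weight ω (u j) = Finsupp.weight ω (v j)) (i : σ)
    (hA : ∀ A : Finset σ, A.Nonempty → i ∉ A →
      ∃ j, ¬ ((u j).support ⊆ A ↔ (v j).support ⊆ A))
    {p : MvPolynomial σ K}
    (hp : p * X i ∈ Ideal.span (Set.range fun j =>
      (monomial (u j) 1 - monomial (v j) 1 : MvPolynomial σ K))) :
    p ∈ Ideal.span (Set.range fun j =>
      (monomial (u j) 1 - monomial (v j) 1 : MvPolynomial σ K)) := by
  classical
  set h : ι → MvPolynomial σ K := fun j => monomial (u j) 1 - monomial (v j) 1 with hh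
  set d : ι → ℕ := fun j => Finsupp.weight ω (u j) with hd
  have hhom : ∀ j, IsWeightedHomogeneous ω (h j) (d j) := fun j =>
    (isWeightedHomogeneous_monomial ω (u j) (1 : K) rfl).sub
      (isWeightedHomogeneous_monomial ω (v j) (1 : K) (huv j).symm)
  set I := Ideal.span (Set.range h) with hI
  have hgr : IsGradedIdeal ω I := isGradedIdeal_span (by rintro _ ⟨j, rfl⟩; exact ⟨_, hhom j⟩)
  by_contra hpI
  obtain ⟨m, hm⟩ : ∃ m, weightedHomogeneousComponent ω m p ∉ I := by
    by_contra! hcon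
    let _ := weightedGradedAlgebra K ω
    exact hpI ((mem_iff_weightedHomogeneousComponent_mem K ω
      (Ideal.homogeneous_span _ _ (by rintro _ ⟨j, rfl⟩; exact ⟨_, hhom j⟩)) p).2 hcon)
  have hmc : weightedHomogeneousComponent ω m p ∈ I.colon {X i} := by
    have := hgr _ hp (m + ω i)
    rw [mul_comm, weightedHomogeneousComponent_mul_of_le (isWeightedHomogeneous_X K ω i) _
      (Nat.le_add_left _ _), Nat.add_sub_cancel] at this
    rwa [Submodule.mem_colon_singleton, smul_eq_mul, mul_comm]
  have hIc : I ≤ I.colon {X i} := fun q hq => by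
    rw [Submodule.mem_colon_singleton, smul_eq_mul]
    exact Ideal.mul_mem_right _ _ hq
  set c : ℝ := ∏ k ∈ ({i} : Finset σ)ᶜ, (ω k : ℝ) with hc
  have hc0 : 0 < c := Finset.prod_pos fun k _ => by exact_mod_cast hω k
  have hprod : (ω i : ℝ) * c = ∏ k, (ω k : ℝ) := by
    rw [hc, Finset.compl_singleton]
    exact Finset.mul_prod_erase _ (fun k => (ω k : ℝ)) (Finset.mem_univ i)
  have key := prod_mul_le_of_forall_lt_one (ω := ω) hcard d i c (ω i + m) (by
    intro z h0 h1
    have e1 := hilbertSeries_span_X (K := K) hω h0 h1 ∅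
    have e2 := prod_mul_hilbertSeries_le (K := K) hω h0 h1 h d hhom Finset.univ
    have e3 := hilbertSeries_eq_add hω hgr (isWeightedHomogeneous_X K ω i) h0 h1
    have e4 := hilbertSeries_add_pow_le hω hIc h0 h1
      (weightedHomogeneousComponent_isWeightedHomogeneous m p) hm hmc
    have e5 := hilbertSeries_binomials_le (K := K) hω h0 h1 u v huv Finset.univ {i}
      (by simpa using hcard) (fun A hAne hAi => by
        simpa using hA A hAne (by simpa using hAi))
    simp only [Finset.coe_empty, Set.image_empty, Ideal.span_empty, Finset.compl_empty] at e1
    simp only [Finset.coe_univ, Set.image_univ, Finset.coe_singleton, Set.image_singleton] at e2 e5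
    change hilbertSeries ω (I ⊔ Ideal.span {X i}) z * c ≤ ∏ j, (d j : ℝ) at e5
    set H := hilbertSeries ω I z
    set B := hilbertSeries ω (⊥ : Ideal (MvPolynomial σ K)) z
    set P := ∏ k, (1 - z ^ ω k)
    set Q := ∏ j, (1 - z ^ d j)
    have hP : 0 ≤ P := Finset.prod_nonneg fun k _ => sub_nonneg.2 (pow_le_one₀ h0.le h1.le)
    have hzi : 0 ≤ 1 - z ^ ω i := sub_nonneg.2 (pow_le_one₀ h0.le h1.le)
    have f1 : (1 - z ^ ω i) * H * c ≤ ∏ j, (d j : ℝ) - z ^ (ω i + m) * c := by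
      have : (1 - z ^ ω i) * H ≤
          hilbertSeries ω (I ⊔ Ideal.span {X i}) z - z ^ (ω i + m) := by
        rw [pow_add]
        nlinarith [mul_le_mul_of_nonneg_left e4 (pow_pos h0 (ω i)).le]
      nlinarith
    calc Q * (1 - z ^ ω i) * c = (Q * B) * ((1 - z ^ ω i) * c * P) := by
          linear_combination (- Q * (1 - z ^ ω i) * c) * e1
      _ ≤ H * ((1 - z ^ ω i) * c * P) := mul_le_mul_of_nonneg_right e2 (by positivity)
      _ = (1 - z ^ ω i) * H * c * P := by ring
      _ ≤ _ := mul_le_mul_of_nonneg_right f1 hP)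
  rw [mul_assoc, hprod, sub_mul] at key
  nlinarith [mul_pos hc0 (hprod ▸ mul_pos (show (0 : ℝ) < ω i by exact_mod_cast hω i) hc0 :
    (0 : ℝ) < ∏ k, (ω k : ℝ))]

end Regular

/-! ### Lattice ideals -/

section Lattice

variable {K : Type*} [Field K] {s : ℕ} {ω : Fin s → ℕ} {𝓛 : AddSubgroup (Fin s → ℤ)}

lemma posExp_apply (a : Fin s → ℤ) (i : Fin s) : posExp a i = (a i).toNat := rfl

lemma weight_posExp (ω : Fin s → ℕ) (a : Fin s → ℤ) :
    Finsupp.weight ω (posExp a) = ∑ i, (a i).toNat * ω i := by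
  rw [Finsupp.weight_apply, Finsupp.sum_fintype _ _ (by simp)]
  rfl

lemma weight_posExp_neg {a : Fin s → ℤ} (h : ∑ i, (ω i : ℤ) * a i = 0) :
    Finsupp.weight ω (posExp a) = Finsupp.weight ω (posExp (-a)) := by
  rw [weight_posExp, weight_posExp]
  zify
  rw [← sub_eq_zero, ← Finset.sum_sub_distrib, ← h]
  refine Finset.sum_congr rfl fun i _ => ?_
  rw [← sub_mul, Pi.neg_apply, mul_comm]
  congr 1
  simp

lemma isWeightedHomogeneous_binomial (h𝓛 : IsHomogeneousLattice ω 𝓛) {a : Fin s → ℤ}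
    (ha : a ∈ 𝓛) :
    IsWeightedHomogeneous ω (binomial K a) (Finsupp.weight ω (posExp a)) :=
  (isWeightedHomogeneous_monomial ω _ (1 : K) rfl).sub
    (isWeightedHomogeneous_monomial ω _ (1 : K) (weight_posExp_neg (h𝓛.2 a ha)).symm)

open Classical in
lemma aeval_indicator_monomial (A : Finset (Fin s)) (u : Fin s →₀ ℕ) :
    aeval (fun i => if i ∈ A then (1 : K) else 0) (monomial u (1 : K)) =
      if u.support ⊆ A then 1 else 0 := by
  rw [aeval_monomial, map_one, one_mul]
  split_ifs with h
  · exact Finset.prod_eq_one fun i hi => by simp [h hi]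
  · obtain ⟨i, hi, hiA⟩ := Finset.not_subset.1 h
    exact Finset.prod_eq_zero hi (by simp [hiA, Finsupp.mem_support_iff.1 hi])

/-- The condition on zeros, read off at points with coordinates in `{0, 1}`. -/
lemma exists_support_of_zeroLocus_eq {G : Set (Fin s → ℤ)} {i : Fin s}
    (hV : zeroLocus K (Ideal.span (binomial K '' G ∪ {X i})) ⊆ ({0} : Set (Fin s → K)))
    {A : Finset (Fin s)} (hA : A.Nonempty) (hi : i ∉ A) :
    ∃ a ∈ G, ¬ ((posExp a).support ⊆ A ↔ (posExp (-a)).support ⊆ A) := by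
  classical
  by_contra! hcon
  obtain ⟨k, hk⟩ := hA
  have hmem : (fun i => if i ∈ A then (1 : K) else 0) ∈
      zeroLocus K (Ideal.span (binomial K '' G ∪ {X i})) := by
    rw [zeroLocus_span]
    rintro p (⟨a, ha, rfl⟩ | rfl)
    · rw [binomial, map_sub, aeval_indicator_monomial, aeval_indicator_monomial]
      simp [hcon a ha]
    · simp [hi]
  have := congrFun (hV hmem) k
  simp [hk] at this

/-- An ideal modulo which the variables are nonzerodivisors contains the lattice ideal as soon as
it contains the binomials of generators of the lattice. -/
lemma latticeIdeal_closure_le {I : Ideal (MvPolynomial (Fin s) K)}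
    (hreg : ∀ i p, p * X i ∈ I → p ∈ I) {G : Set (Fin s → ℤ)} (hG : ∀ a ∈ G, binomial K a ∈ I) :
    latticeIdeal K (AddSubgroup.closure G) ≤ I := by
  have hreg' : ∀ (u : Fin s →₀ ℕ) p, p * monomial u 1 ∈ I → p ∈ I := by
    intro u
    induction u using Finsupp.induction_linear with
    | zero => intro p hp; simpa using hp
    | add u v hu hv =>
      intro p hp
      refine hu p (hv _ ?_)
      rwa [mul_assoc, monomial_mul, one_mul]
    | single a b =>
      intro p hp
      rw [← X_pow_eq_monomial] at hp
      induction b with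
      | zero => simpa using hp
      | succ b ih => exact ih (hreg a _ (by rwa [pow_succ, ← mul_assoc] at hp))
  -- Only the difference of the exponents of a binomial matters modulo `I`.
  have hdiff : ∀ (a : Fin s → ℤ) (u v : Fin s →₀ ℕ), (∀ i, (u i : ℤ) - v i = a i) →
      (binomial K a ∈ I ↔ (monomial u 1 - monomial v 1 : MvPolynomial (Fin s) K) ∈ I) := by
    intro a u v huv
    have e1 : u + posExp (-a) = v + posExp a := by
      ext i
      have := huv i
      simp only [Finsupp.add_apply, posExp_apply, Pi.neg_apply]
      omega
    have e2 : (monomial u 1 - monomial v 1 : MvPolynomial (Fin s) K) * monomial (posExp a) 1 =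
        binomial K a * monomial u 1 := by
      rw [binomial, sub_mul, sub_mul]
      simp only [monomial_mul, one_mul]
      rw [← e1, add_comm u (posExp a), add_comm u (posExp (-a))]
    constructor
    · intro h
      exact hreg' (posExp a) _ (e2 ▸ Ideal.mul_mem_right _ _ h)
    · intro h
      exact hreg' u _ (e2 ▸ Ideal.mul_mem_right _ _ h)
  refine Ideal.span_le.2 ?_
  rintro _ ⟨a, ha, rfl⟩
  induction ha using AddSubgroup.closure_induction with
  | mem a ha => exact hG a ha
  | zero => simp [binomial]
  | add a b _ _ ha hb =>
    rw [SetLike.mem_coe] at ha hb ⊢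
    rw [hdiff (a + b) (posExp a + posExp b) (posExp (-a) + posExp (-b)) (by
      intro i
      simp only [Finsupp.add_apply, posExp_apply, Pi.neg_apply, Pi.add_apply]
      omega)]
    have : (monomial (posExp a + posExp b) 1 - monomial (posExp (-a) + posExp (-b)) 1 :
        MvPolynomial (Fin s) K) =
        binomial K a * monomial (posExp b) 1 + binomial K b * monomial (posExp (-a)) 1 := by
      rw [binomial, binomial, sub_mul, sub_mul]
      simp only [monomial_mul, one_mul]
      rw [add_comm (posExp b) (posExp (-a)), add_comm (posExp (-b)) (posExp (-a))]
      ring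
    rw [this]
    exact add_mem (Ideal.mul_mem_right _ _ ha) (Ideal.mul_mem_right _ _ hb)
  | neg a _ ha =>
    have : binomial K (-a) = - binomial K a := by simp [binomial]
    rw [this]
    exact neg_mem ha

lemma binomial_mem_latticeIdeal {a : Fin s → ℤ} (ha : a ∈ 𝓛) : binomial K a ∈ latticeIdeal K 𝓛 :=
  Ideal.subset_span ⟨a, ha, rfl⟩

lemma span_eq_latticeIdeal_of_isAdmissible (h𝓛 : IsHomogeneousLattice ω 𝓛)
    {h : Fin (s - 1) → MvPolynomial (Fin s) K} {a : Fin (s - 1) → Fin s → ℤ}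
    (H : IsAdmissible ω 𝓛 h a) : Ideal.span (Set.range h) = latticeIdeal K 𝓛 := by
  obtain rfl : h = fun j => binomial K (a j) := funext H.eq_binomial
  have ha : ∀ j, a j ∈ 𝓛 := fun j => H.closure_eq ▸ AddSubgroup.subset_closure ⟨j, rfl⟩
  refine le_antisymm (Ideal.span_le.2 ?_) ?_
  · rintro _ ⟨j, rfl⟩
    exact H.mem j
  · rw [← H.closure_eq]
    refine latticeIdeal_closure_le (fun i p hp => ?_) ?_
    · refine mem_of_mul_X_mem h𝓛.1 ?_ _ _ (fun j => weight_posExp_neg (h𝓛.2 _ (ha j))) i ?_ hp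
      · simpa using Nat.sub_add_cancel i.pos
      · intro A hA hi
        have := exists_support_of_zeroLocus_eq (K := K) (G := Set.range a) (i := i) (by
          rw [← Set.range_comp]
          exact (H.zeroLocus_eq i).subset) hA hi
        simpa using this
    · rintro _ ⟨j, rfl⟩
      exact Ideal.subset_span ⟨j, rfl⟩

end Lattice

/-! ### The height of the lattice ideal -/

section HeightUpper

variable {K : Type*} [Field K] {s : ℕ} {ω : Fin s → ℕ} {𝓛 : AddSubgroup (Fin s → ℤ)}

/-- The kernel of `t_k ↦ x ^ ω_k` is a prime containing the lattice ideal and properly contained in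
the ideal of the origin, whose height is at most `s`. -/
lemma height_latticeIdeal_le (h𝓛 : IsHomogeneousLattice ω 𝓛) (i : Fin s) :
    (latticeIdeal K 𝓛).height ≤ (s - 1 : ℕ) := by
  set φ : MvPolynomial (Fin s) K →ₐ[K] Polynomial K := aeval fun k => Polynomial.X ^ ω k with hφ
  set ε : MvPolynomial (Fin s) K →ₐ[K] K := aeval fun _ => 0 with hε
  have hφε : ε = (Polynomial.aeval (0 : K)).comp φ := by
    ext k
    simp [hφ, hε, (h𝓛.1 k).ne']
  have hPp : (RingHom.ker φ).IsPrime := RingHom.ker_isPrime _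
  have hmp : (RingHom.ker ε).IsPrime := RingHom.ker_isPrime _
  have hlt : RingHom.ker φ < RingHom.ker ε := by
    refine SetLike.lt_iff_le_and_exists.2 ⟨fun p hp => ?_, X i, ?_, ?_⟩
    · rw [RingHom.mem_ker] at hp ⊢
      rw [hφε, AlgHom.comp_apply, hp, map_zero]
    · simp [RingHom.mem_ker, hε]
    · simp [RingHom.mem_ker, hφ]
  have hmon : ∀ u : Fin s →₀ ℕ, φ (monomial u 1) = Polynomial.X ^ Finsupp.weight ω u := by
    intro u
    rw [hφ, aeval_monomial, map_one, one_mul, Finsupp.weight_apply, Finsupp.prod, Finsupp.sum,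
      ← Finset.prod_pow_eq_pow_sum]
    refine Finset.prod_congr rfl fun k _ => ?_
    rw [← pow_mul, smul_eq_mul, mul_comm]
  have hle : latticeIdeal K 𝓛 ≤ RingHom.ker φ := by
    refine Ideal.span_le.2 ?_
    rintro _ ⟨a, ha, rfl⟩
    rw [SetLike.mem_coe, RingHom.mem_ker, binomial, map_sub, hmon, hmon,
      weight_posExp_neg (h𝓛.2 a ha), sub_self]
  have h1 := (add_le_add_left (Ideal.height_mono hle) 1).trans
    (Ideal.height_add_one_le_of_lt_of_isPrime hlt)
  have h2 : (RingHom.ker ε).height ≤ s := by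
    have := Ideal.height_le_ringKrullDim_of_ne_top hmp.ne_top
    rw [MvPolynomial.ringKrullDim_of_isNoetherianRing, ringKrullDim_eq_zero_of_field, zero_add,
      Nat.card_eq_fintype_card, Fintype.card_fin] at this
    exact_mod_cast this
  have h3 := h1.trans h2
  obtain ⟨n, rfl⟩ : ∃ n, s = n + 1 := ⟨s - 1, by have := i.pos; omega⟩
  rw [Nat.cast_add, Nat.cast_one] at h3
  exact (ENat.add_le_add_iff_right ENat.one_ne_top).1 h3

end HeightUpper

section Prime

lemma height_comap_le_of_isIntegral {R S : Type*} [CommRing R] [CommRing S] [IsDomain S]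
    [IsIntegrallyClosed R] [IsNoetherianRing R] [IsNoetherianRing S] (f : R →+* S)
    (hf : Function.Injective f) (hint : f.IsIntegral) (P : Ideal S) [P.IsPrime] :
    (P.comap f).height ≤ P.height := by
  algebraize [f]
  have : FaithfulSMul R S := (faithfulSMul_iff_algebraMap_injective R S).2 hf
  have : Algebra.IsIntegral R S := ⟨hint⟩
  have : P.LiesOver (P.comap f) := ⟨rfl⟩
  rw [Ideal.height_eq_height_add_of_liesOver_of_hasGoingDown (P.comap f) P]
  exact le_self_add

variable {K : Type*} [Field K] {σ : Type*}

/-- The substitution `t_k ↦ t_k ^ E_k`. -/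
noncomputable def powerMap (K : Type*) [Field K] {σ : Type*} (E : σ → ℕ) :
    MvPolynomial σ K →ₐ[K] MvPolynomial σ K :=
  aeval fun k => X k ^ E k

lemma powerMap_injective [Fintype σ] {E : σ → ℕ} (hE : ∀ k, 0 < E k) :
    Function.Injective (powerMap K E) := by
  classical
  let e : (σ →₀ ℕ) → (σ →₀ ℕ) := fun u => Finsupp.equivFunOnFinite.symm fun k => u k * E k
  have he : Function.Injective e := fun u v h => Finsupp.ext fun k =>
    Nat.eq_of_mul_eq_mul_right (hE k) (DFunLike.congr_fun h k)
  have hmon : ∀ (u : σ →₀ ℕ) (a : K), powerMap K E (monomial u a) = monomial (e u) a := by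
    intro u a
    rw [powerMap, aeval_monomial, monomial_eq (s := e u), algebraMap_eq,
      Finsupp.prod_fintype _ _ (by simp), Finsupp.prod_fintype _ _ (by simp)]
    congr 1
    refine Finset.prod_congr rfl fun k _ => ?_
    rw [← pow_mul, mul_comm]
    rfl
  have hcoeff : ∀ p u, coeff (e u) (powerMap K E p) = coeff u p := by
    intro p u
    induction p using MvPolynomial.induction_on' with
    | monomial v a => simp [hmon, coeff_monomial, he.eq_iff]
    | add p q hp hq => simp [hp, hq]
  intro p q h
  ext u
  rw [← hcoeff, h, hcoeff]

lemma powerMap_isIntegral {E : σ → ℕ} (hE : ∀ k, 0 < E k) :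
    (powerMap K E : MvPolynomial σ K →+* MvPolynomial σ K).IsIntegral := by
  intro p
  induction p using MvPolynomial.induction_on with
  | C a =>
    have := RingHom.isIntegralElem_map
      (powerMap K E : MvPolynomial σ K →+* MvPolynomial σ K) (x := C a)
    simpa [powerMap] using this
  | add p q hp hq => exact hp.add _ hq
  | mul_X p k hp =>
    refine hp.mul _ ⟨Polynomial.X ^ E k - Polynomial.C (X k),
      Polynomial.monic_X_pow_sub_C _ (hE k).ne', ?_⟩
    simp [powerMap]

/-- Primes containing all differences of variables: the chain of the kernels of the maps
identifying the variables of `T` with `t_i`, for growing `T`. -/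
lemma card_le_height_of_X_sub_X_mem [Fintype σ] (i : σ) (Q : Ideal (MvPolynomial σ K))
    (hQ : ∀ j, X j - X i ∈ Q) : ((Fintype.card σ - 1 : ℕ) : ℕ∞) ≤ Q.height := by
  classical
  set φ : Finset σ → MvPolynomial σ K →ₐ[K] MvPolynomial σ K :=
    fun T => aeval fun j => if j ∈ T then X i else X j with hφ
  have hφX : ∀ T j, φ T (X j) = if j ∈ T then X i else X j := fun T j => by simp [hφ]
  have hprime : ∀ T, (RingHom.ker (φ T)).IsPrime := fun T => RingHom.ker_isPrime _
  have hchain : ∀ T : Finset σ, i ∉ T → (T.card : ℕ∞) ≤ (RingHom.ker (φ T)).height := by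
    intro T
    induction T using Finset.induction_on with
    | empty => simp
    | insert j T hj ih =>
      intro hi
      rw [Finset.mem_insert, not_or] at hi
      rw [Finset.card_insert_of_notMem hj, Nat.cast_add, Nat.cast_one]
      refine (add_le_add_left (ih hi.2) 1).trans (Ideal.height_add_one_le_of_lt_of_isPrime ?_)
      have hcomp : φ (insert j T) = (φ (insert j T)).comp (φ T) := by
        refine MvPolynomial.algHom_ext fun k => ?_
        rw [AlgHom.comp_apply, hφX T]
        split_ifs with hk
        · rw [hφX, hφX, if_pos (Finset.mem_insert_of_mem hk)]
          simp [hi.1, hi.2]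
        · rfl
      refine SetLike.lt_iff_le_and_exists.2 ⟨fun p hp => ?_, X j - X i, ?_, ?_⟩
      · rw [RingHom.mem_ker] at hp ⊢
        rw [hcomp, AlgHom.comp_apply, hp, map_zero]
      · rw [RingHom.mem_ker, map_sub, hφX, hφX]
        simp [hi.1, hi.2]
      · rw [RingHom.mem_ker, map_sub, hφX, hφX, if_neg hj, if_neg hi.2, sub_eq_zero]
        exact fun h => hi.1 (X_injective h).symm
  have hle : RingHom.ker (φ (Finset.univ.erase i)) ≤ Q := by
    have h1 : (Ideal.Quotient.mkₐ K Q).comp (φ (Finset.univ.erase i)) = Ideal.Quotient.mkₐ K Q := by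
      refine MvPolynomial.algHom_ext fun k => ?_
      rw [AlgHom.comp_apply, hφX]
      split_ifs with hk
      · simp only [Ideal.Quotient.mkₐ_eq_mk]
        rw [eq_comm, Ideal.Quotient.eq]
        exact hQ k
      · rfl
    intro p hp
    rw [RingHom.mem_ker] at hp
    have := DFunLike.congr_fun h1 p
    rw [AlgHom.comp_apply, hp, map_zero, eq_comm, Ideal.Quotient.mkₐ_eq_mk,
      Ideal.Quotient.eq_zero_iff_mem] at this
    exact this
  have := hchain (Finset.univ.erase i) (Finset.notMem_erase i _)
  rw [Finset.card_erase_of_mem (Finset.mem_univ i), Finset.card_univ] at this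
  exact this.trans (Ideal.height_mono hle)

end Prime

section HeightLower

variable {K : Type*} [Field K] {s : ℕ} {ω : Fin s → ℕ} {𝓛 : AddSubgroup (Fin s → ℤ)}

lemma exists_nsmul_mem_of_mem_span {x : Fin s → ℚ}
    (hx : x ∈ Submodule.span ℚ ((fun a k => ((a k : ℤ) : ℚ)) '' (𝓛 : Set (Fin s → ℤ)))) :
    ∃ N : ℕ, 0 < N ∧ ∃ b ∈ 𝓛, ∀ k, (N : ℚ) * x k = (b k : ℤ) := by
  induction hx using Submodule.span_induction with
  | mem x hx =>
    obtain ⟨b, hb, rfl⟩ := hx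
    exact ⟨1, one_pos, b, hb, by simp⟩
  | zero => exact ⟨1, one_pos, 0, zero_mem _, by simp⟩
  | add x y _ _ hx hy =>
    obtain ⟨N, hN, b, hb, hbx⟩ := hx
    obtain ⟨M, hM, c, hc, hcy⟩ := hy
    refine ⟨N * M, Nat.mul_pos hN hM, (M : ℤ) • b + (N : ℤ) • c,
      add_mem (zsmul_mem hb _) (zsmul_mem hc _), fun k => ?_⟩
    simp only [Pi.add_apply, Pi.smul_apply, smul_eq_mul]
    push_cast
    rw [← hbx, ← hcy]
    ring
  | smul q x _ hx =>
    obtain ⟨N, hN, b, hb, hbx⟩ := hx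
    refine ⟨N * q.den, Nat.mul_pos hN q.den_pos, q.num • b, zsmul_mem hb _, fun k => ?_⟩
    simp only [Pi.smul_apply, smul_eq_mul]
    push_cast
    rw [← hbx]
    have : (q.den : ℚ) * q = q.num := by rw [mul_comm]; exact Rat.mul_den_eq_num q
    linear_combination (N : ℚ) * x k * this

/-- The hypothesis on zeros forces the lattice to have full rank in `ω^⊥`. Otherwise some rational
vector `c ≥ 0` orthogonal to the lattice has both zero and nonzero entries, and the point with
coordinates `1` where `c` vanishes and `0` elsewhere contradicts the hypothesis. -/
lemma exists_nsmul_mem (h𝓛 : IsHomogeneousLattice ω 𝓛)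
    (hA : ∀ (i : Fin s) (A : Finset (Fin s)), A.Nonempty → i ∉ A →
      ∃ a ∈ 𝓛, ¬ ((posExp a).support ⊆ A ↔ (posExp (-a)).support ⊆ A)) (i j : Fin s) :
    ∃ N : ℕ, 0 < N ∧
      (N : ℤ) • ((ω i : ℤ) • Pi.single j 1 - (ω j : ℤ) • Pi.single i 1 : Fin s → ℤ) ∈ 𝓛 := by
  set w : Fin s → ℚ := (ω i : ℚ) • Pi.single j 1 - (ω j : ℚ) • Pi.single i 1 with hw
  by_cases hmem : w ∈ Submodule.span ℚ ((fun a k => ((a k : ℤ) : ℚ)) '' (𝓛 : Set (Fin s → ℤ)))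
  · obtain ⟨N, hN, b, hb, hbw⟩ := exists_nsmul_mem_of_mem_span hmem
    refine ⟨N, hN, ?_⟩
    suffices h : (N : ℤ) • ((ω i : ℤ) • Pi.single j 1 - (ω j : ℤ) • Pi.single i 1) = b by
      rwa [h]
    ext k
    have := hbw k
    have h2 : (((N : ℤ) • ((ω i : ℤ) • Pi.single j 1 - (ω j : ℤ) • Pi.single i 1 : Fin s → ℤ)) k
        : ℚ) = N * w k := by
      simp [hw, Pi.single_apply]
    rw [this] at h2
    exact_mod_cast h2
  exfalso
  obtain ⟨φ, hφw, hφ⟩ := Submodule.exists_le_ker_of_notMem hmem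
  have hφa : ∀ x : Fin s → ℚ, φ x = ∑ k, x k * φ (Pi.single k 1) := fun x => by
    conv_lhs => rw [pi_eq_sum_univ' x]
    simp [map_sum]
  have hω : ∀ k, (0 : ℚ) < ω k := fun k => by exact_mod_cast h𝓛.1 k
  obtain ⟨k0, -, hk0⟩ := Finset.exists_min_image Finset.univ
    (fun k => φ (Pi.single k 1) / ω k) ⟨i, Finset.mem_univ i⟩
  set r := φ (Pi.single k0 1) / ω k0 with hr
  set c : Fin s → ℚ := fun k => φ (Pi.single k 1) - r * ω k with hc
  have hc0 : ∀ k, 0 ≤ c k := fun k => by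
    have := hk0 k (Finset.mem_univ k)
    rw [le_div_iff₀ (hω k)] at this
    exact sub_nonneg.2 this
  have hck0 : c k0 = 0 := by
    simp only [hc, hr]
    rw [div_mul_cancel₀ _ (hω k0).ne', sub_self]
  obtain ⟨k1, hk1⟩ : ∃ k, c k ≠ 0 := by
    by_contra! hcon
    refine hφw ?_
    have h1 := hcon i
    have h2 := hcon j
    simp only [hc, sub_eq_zero] at h1 h2
    rw [hw, map_sub, map_smul, map_smul, h1, h2, smul_eq_mul, smul_eq_mul]
    ring
  obtain ⟨a, ha, hne⟩ := hA k1 (Finset.univ.filter fun k => c k = 0) ⟨k0, by simpa using hck0⟩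
    (by simpa using hk1)
  have hsum : ∑ k, c k * (posExp a k : ℚ) = ∑ k, c k * (posExp (-a) k : ℚ) := by
    have h1 : ∑ k, (a k : ℚ) * φ (Pi.single k 1) = 0 := by
      rw [← hφa fun k => (a k : ℚ)]
      exact hφ (Submodule.subset_span ⟨a, ha, rfl⟩)
    have h2 : ∑ k, (ω k : ℚ) * a k = 0 := by exact_mod_cast h𝓛.2 a ha
    have h3 : ∑ k, c k * (a k : ℚ) = 0 := by
      calc _ = ∑ k, (a k : ℚ) * φ (Pi.single k 1) - r * ∑ k, (ω k : ℚ) * a k := by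
            rw [Finset.mul_sum, ← Finset.sum_sub_distrib]
            exact Finset.sum_congr rfl fun k _ => by simp only [hc]; ring
        _ = 0 := by rw [h1, h2]; ring
    rw [← sub_eq_zero, ← Finset.sum_sub_distrib, ← h3]
    refine Finset.sum_congr rfl fun k _ => ?_
    rw [← mul_sub]
    congr 1
    have : ((posExp a k : ℤ) - posExp (-a) k : ℤ) = a k := by
      simp [posExp_apply]
    exact_mod_cast this
  have hiff : ∀ u : Fin s →₀ ℕ, u.support ⊆ (Finset.univ.filter fun k => c k = 0) ↔
      ∑ k, c k * (u k : ℚ) = 0 := by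
    intro u
    rw [Finset.sum_eq_zero_iff_of_nonneg fun k _ => mul_nonneg (hc0 k) (Nat.cast_nonneg _)]
    simp only [Finset.subset_iff, Finsupp.mem_support_iff, Finset.mem_filter, Finset.mem_univ,
      true_and, mul_eq_zero, Nat.cast_eq_zero, true_imp_iff]
    exact forall_congr' fun k => by tauto
  exact hne (by rw [hiff, hiff, hsum])

/-- A prime containing the lattice ideal contains binomials `t_j ^ E_j - t_i ^ E_i`. Its
contraction along the integral map `t_k ↦ t_k ^ E_k` contains all `t_j - t_i`, and going down bounds
its height below. -/
lemma le_height_latticeIdeal (h𝓛 : IsHomogeneousLattice ω 𝓛)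
    (hA : ∀ (i : Fin s) (A : Finset (Fin s)), A.Nonempty → i ∉ A →
      ∃ a ∈ 𝓛, ¬ ((posExp a).support ⊆ A ↔ (posExp (-a)).support ⊆ A)) (i : Fin s) :
    ((s - 1 : ℕ) : ℕ∞) ≤ (latticeIdeal K 𝓛).height := by
  choose N hN hmem using exists_nsmul_mem h𝓛 hA i
  set E : Fin s → ℕ := fun k => (∏ l, N l) * ω i * ∏ l ∈ Finset.univ.erase k, ω l with hE
  have hEpos : ∀ k, 0 < E k := fun k =>
    Nat.mul_pos (Nat.mul_pos (Finset.prod_pos fun l _ => hN l) (h𝓛.1 i))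
      (Finset.prod_pos fun l _ => h𝓛.1 l)
  have hX : ∀ j, (X j ^ E j - X i ^ E i : MvPolynomial (Fin s) K) ∈ latticeIdeal K 𝓛 := by
    intro j
    rcases eq_or_ne j i with rfl | hji
    · simp
    have hb : (E j : ℤ) • Pi.single j 1 - (E i : ℤ) • Pi.single i 1 ∈ 𝓛 := by
      have := zsmul_mem (hmem j) ((∏ l ∈ Finset.univ.erase j, N l : ℕ) *
        (∏ l ∈ Finset.univ.erase j, ω l : ℕ) : ℤ)
      convert this using 1
      have h1 : (∏ l, N l) = N j * ∏ l ∈ Finset.univ.erase j, N l :=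
        (Finset.mul_prod_erase _ N (Finset.mem_univ j)).symm
      have h2 : ω i * ∏ l ∈ Finset.univ.erase i, ω l = ω j * ∏ l ∈ Finset.univ.erase j, ω l := by
        rw [Finset.mul_prod_erase _ ω (Finset.mem_univ i),
          Finset.mul_prod_erase _ ω (Finset.mem_univ j)]
      have h3 : E j = (∏ l ∈ Finset.univ.erase j, N l) * (∏ l ∈ Finset.univ.erase j, ω l) * N j *
          ω i := by
        simp only [hE, h1]; ring
      have h4 : E i = (∏ l ∈ Finset.univ.erase j, N l) * (∏ l ∈ Finset.univ.erase j, ω l) * N j *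
          ω j := by
        simp only [hE, mul_assoc, h2]; rw [h1]; ring
      rw [h3, h4, smul_sub, smul_sub]
      simp only [smul_smul]
      push_cast
      simp only [mul_assoc]
    have := binomial_mem_latticeIdeal (K := K) hb
    have e1 : posExp ((E j : ℤ) • Pi.single j 1 - (E i : ℤ) • Pi.single i 1) =
        Finsupp.single j (E j) := by
      ext k
      rcases eq_or_ne k j with rfl | hkj
      · simp [posExp_apply, hji]
      · rcases eq_or_ne k i with rfl | hki
        · simp [posExp_apply, hkj]
        · simp [posExp_apply, hkj, hki]
    have e2 : posExp (-((E j : ℤ) • Pi.single j 1 - (E i : ℤ) • Pi.single i 1)) =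
        Finsupp.single i (E i) := by
      ext k
      rcases eq_or_ne k i with rfl | hki
      · simp [posExp_apply, hji.symm]
      · rcases eq_or_ne k j with rfl | hkj
        · simp [posExp_apply, hki]
        · simp [posExp_apply, hkj, hki]
    rwa [binomial, e1, e2, ← X_pow_eq_monomial, ← X_pow_eq_monomial] at this
  rw [Ideal.height_eq_inf_minimalPrimes]
  refine le_iInf₂ fun P hP => ?_
  have := hP.1.1
  refine le_trans ?_ (height_comap_le_of_isIntegral
    (powerMap K E : MvPolynomial (Fin s) K →+* MvPolynomial (Fin s) K)
    (powerMap_injective hEpos) (powerMap_isIntegral hEpos) P)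
  have := card_le_height_of_X_sub_X_mem i
    (P.comap (powerMap K E : MvPolynomial (Fin s) K →+* MvPolynomial (Fin s) K)) (fun j => by
      rw [Ideal.mem_comap]
      simpa [powerMap] using hP.1.2 (hX j))
  rwa [Fintype.card_fin] at this

end HeightLower

/-! ### Generators among the binomials -/

section Nakayama

variable {K : Type*} [Field K] {σ : Type*} {ω : σ → ℕ}

/-- Graded Nakayama: homogeneous elements of `I` that span it modulo `(t_k) * I` generate it. -/
lemma span_eq_of_le_sup (hω : ∀ i, 0 < ω i) {I : Ideal (MvPolynomial σ K)}
    {T : Set (MvPolynomial σ K)} (hTI : T ⊆ I)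
    (hT : ∀ f ∈ T, ∃ d, IsWeightedHomogeneous ω f d)
    (hle : I ≤ Ideal.span T ⊔ Ideal.span (Set.range X) * I) : Ideal.span T = I := by
  classical
  refine le_antisymm (Ideal.span_le.2 hTI) fun x hx => ?_
  let _ := weightedGradedAlgebra K ω
  refine (mem_iff_weightedHomogeneousComponent_mem K ω (Ideal.homogeneous_span _ _ hT) x).2
    fun n => ?_
  induction n using Nat.strong_induction_on generalizing x with
  | _ n ih =>
    have hlow : ∀ p ∈ Ideal.span (Set.range (X : σ → MvPolynomial σ K)), ∀ q ∈ I,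
        weightedHomogeneousComponent ω n (p * q) ∈ Ideal.span T := by
      intro p hp
      induction hp using Submodule.span_induction with
      | mem p hp =>
        obtain ⟨k, rfl⟩ := hp
        intro q hq
        rcases lt_or_ge n (ω k) with h | h
        · rw [weightedHomogeneousComponent_mul_of_lt (isWeightedHomogeneous_X K ω k) _ h]
          exact zero_mem _
        · rw [weightedHomogeneousComponent_mul_of_le (isWeightedHomogeneous_X K ω k) _ h]
          exact Ideal.mul_mem_left _ _ (ih _ (Nat.sub_lt ((hω k).trans_le h) (hω k)) q hq)
      | zero => intro q _; simp
      | add p p' _ _ hp hp' =>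
        intro q hq
        rw [add_mul, map_add]
        exact add_mem (hp q hq) (hp' q hq)
      | smul a p _ hp =>
        intro q hq
        rw [smul_eq_mul, mul_comm a p, mul_assoc]
        exact hp _ (Ideal.mul_mem_left _ _ hq)
    obtain ⟨y, hy, w, hw, rfl⟩ := Submodule.mem_sup.1 (hle hx)
    rw [map_add]
    refine add_mem (isGradedIdeal_span hT y hy n) ?_
    clear hx
    induction hw using Submodule.mul_induction_on' with
    | mem_mul_mem p hp q hq => exact hlow p hp q hq
    | add a _ b _ ha hb => rw [map_add]; exact add_mem ha hb

/-- If a homogeneous ideal is generated by `r` elements, then `r` elements suffice from any given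
set `G` of homogeneous generators: take a basis of `I / (t_k) * I` from `G`. -/
lemma exists_generators_mem (hω : ∀ i, 0 < ω i) {I : Ideal (MvPolynomial σ K)}
    {G : Set (MvPolynomial σ K)} (hG : ∀ f ∈ G, ∃ d, IsWeightedHomogeneous ω f d)
    (hGI : Ideal.span G = I) (hG0 : 0 ∈ G) {r n : ℕ} (g : Fin r → MvPolynomial σ K)
    (hg : Ideal.span (Set.range g) = I) (hrn : r ≤ n) :
    ∃ b : Fin n → MvPolynomial σ K, (∀ j, b j ∈ G) ∧ Ideal.span (Set.range b) = I := by
  classical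
  set 𝔪 : Ideal (MvPolynomial σ K) := Ideal.span (Set.range X) with h𝔪
  set π := Ideal.Quotient.mkₐ K (𝔪 * I) with hπ
  have hπ0 : ∀ x, π x = 0 ↔ x ∈ 𝔪 * I := fun x => Ideal.Quotient.eq_zero_iff_mem
  have hspan : ∀ H : Set (MvPolynomial σ K), Ideal.span H = I →
      ∀ x ∈ I, π x ∈ Submodule.span K (π '' H) := by
    intro H hH x hx
    rw [← hH] at hx
    induction hx using Submodule.span_induction with
    | mem x hx => exact Submodule.subset_span ⟨x, hx, rfl⟩
    | zero => simp
    | add x y _ _ hx hy =>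
      rw [map_add]
      exact add_mem hx hy
    | smul p x hxH hx =>
      -- Modulo `(t_k) * I`, a polynomial acts on `I` through its constant coefficient.
      have hp : p - C (coeff 0 p) ∈ 𝔪 := by
        rw [h𝔪, ← Set.image_univ, mem_ideal_span_X_image]
        intro m hm
        by_contra! hcon
        have : m = 0 := Finsupp.ext fun i => hcon i trivial
        subst this
        simp at hm
      have : π (p • x) = coeff 0 p • π x := by
        rw [← map_smul, ← sub_eq_zero, ← map_sub, hπ0, smul_eq_mul, smul_eq_C_mul, ← sub_mul]
        exact Ideal.mul_mem_mul hp (hH ▸ hxH)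
      rw [this]
      exact Submodule.smul_mem _ _ hx
  obtain ⟨b, hbG, hbspan, hbli⟩ := exists_linearIndependent K (π '' G)
  have hcard : Cardinal.mk b ≤ r := by
    have hle : Set.range ((↑) : b → MvPolynomial σ K ⧸ 𝔪 * I) ⊆
        Submodule.span K (Set.range (π ∘ g)) := by
      rw [Subtype.range_coe]
      intro x hx
      obtain ⟨f, hf, rfl⟩ := hbG hx
      rw [Set.range_comp]
      exact hspan _ hg _ (hGI ▸ Ideal.subset_span hf)
    refine (linearIndependent_le_span' _ hbli _ hle).trans ?_
    have := Fintype.card_le_of_surjective _ (Set.rangeFactorization_surjective (f := π ∘ g))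
    rw [Fintype.card_fin] at this
    exact_mod_cast this
  have hbfin : b.Finite :=
    Cardinal.lt_aleph0_iff_set_finite.1 (hcard.trans_lt Cardinal.natCast_lt_aleph0)
  obtain ⟨T, hTG, hTb⟩ := (show Set.SurjOn π G b from hbG).exists_bijOn_subset
  have hTfin : T.Finite := hTb.finite_iff_finite.2 hbfin
  have hTcard : T.ncard ≤ n := by
    have h1 : T.ncard = b.ncard := by rw [← hTb.image_eq, hTb.injOn.ncard_image]
    have h2 : b.ncard ≤ r := by
      rw [← Set.cast_ncard hbfin] at hcard
      exact_mod_cast hcard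
    omega
  have hGT : ∀ f ∈ G, f ∈ I := fun f hf => hGI ▸ Ideal.subset_span hf
  have hT : Ideal.span T = I := by
    refine span_eq_of_le_sup hω (fun f hf => hGT f (hTG hf))
      (fun f hf => hG f (hTG hf)) fun x hx => ?_
    have h1 := hspan G hGI x hx
    rw [← hbspan, ← hTb.image_eq, ← AlgHom.coe_toLinearMap, ← Submodule.map_span] at h1
    obtain ⟨y, hy, hyx⟩ := Submodule.mem_map.1 h1
    rw [← sub_add_cancel x y, add_comm]
    refine Submodule.add_mem_sup (Submodule.span_le_restrictScalars K _ T hy) ((hπ0 _).1 ?_)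
    rw [map_sub, sub_eq_zero]
    exact hyx.symm
  -- Enumerate `T` by the first indices and fill up with zeros.
  have : Finite T := hTfin
  have e := Finite.equivFin T
  rw [Nat.card_coe_set_eq] at e
  refine ⟨fun j => if hj : (j : ℕ) < T.ncard then (e.symm ⟨j, hj⟩ : MvPolynomial σ K) else 0,
    fun j => ?_, le_antisymm (Ideal.span_le.2 ?_) ?_⟩
  · dsimp only
    split_ifs with hj
    · exact hTG (e.symm ⟨j, hj⟩).2
    · exact hG0
  · rintro _ ⟨j, rfl⟩
    dsimp only
    split_ifs with hj
    · exact hGT _ (hTG (e.symm ⟨j, hj⟩).2)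
    · exact zero_mem _
  · rw [← hT]
    refine Ideal.span_mono fun f hf => ?_
    exact ⟨⟨e ⟨f, hf⟩, (e ⟨f, hf⟩).2.trans_le hTcard⟩, by simp⟩

end Nakayama

section Closure

variable {K : Type*} [Field K] {s : ℕ} {ω : Fin s → ℕ} {𝓛 : AddSubgroup (Fin s → ℤ)}

/-- Vectors whose binomials generate the lattice ideal generate the lattice: the quotient by the
binomials maps to the group algebra of `ℤ^s` modulo the subgroup that they generate. -/
lemma closure_eq_of_span_eq {G : Set (Fin s → ℤ)} (hG : G ⊆ 𝓛)
    (h : Ideal.span (binomial K '' G) = latticeIdeal K 𝓛) : AddSubgroup.closure G = 𝓛 := by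
  refine le_antisymm ((AddSubgroup.closure_le 𝓛).2 hG) fun a ha => ?_
  set Λ := AddSubgroup.closure G with hΛ
  let φ : MvPolynomial (Fin s) K →ₐ[K] AddMonoidAlgebra K ((Fin s → ℤ) ⧸ Λ) :=
    aeval fun k => AddMonoidAlgebra.single (QuotientAddGroup.mk (Pi.single k 1)) 1
  have hmon : ∀ u : Fin s →₀ ℕ, φ (monomial u 1) =
      AddMonoidAlgebra.single (QuotientAddGroup.mk fun k => (u k : ℤ)) 1 := by
    intro u
    induction u using Finsupp.induction_linear with
    | zero => exact map_one φ
    | add u v hu hv =>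
      have : (monomial (u + v) 1 : MvPolynomial (Fin s) K) = monomial u 1 * monomial v 1 := by
        rw [monomial_mul, one_mul]
      rw [this, map_mul, hu, hv, AddMonoidAlgebra.single_mul_single, one_mul,
        ← QuotientAddGroup.mk_add]
      congr 2
    | single k b =>
      rw [← X_pow_eq_monomial, map_pow]
      simp only [φ, aeval_X]
      rw [AddMonoidAlgebra.single_pow, one_pow, ← QuotientAddGroup.mk_nsmul]
      congr 2
      ext l
      rcases eq_or_ne l k with rfl | hl
      · simp
      · simp [hl, Finsupp.single_eq_of_ne hl]
  have hbin : ∀ a, φ (binomial K a) = 0 ↔ a ∈ Λ := by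
    intro a
    have : a = - (fun k => (posExp (-a) k : ℤ)) + (fun k => (posExp a k : ℤ)) := by
      ext k
      simp only [Pi.add_apply, Pi.neg_apply, posExp_apply]
      omega
    rw [binomial, map_sub, hmon, hmon, sub_eq_zero, AddMonoidAlgebra.single_left_inj one_ne_zero,
      eq_comm, QuotientAddGroup.eq, ← this]
  have hle : latticeIdeal K 𝓛 ≤ RingHom.ker φ := by
    rw [← h, Ideal.span_le]
    rintro _ ⟨a, ha, rfl⟩
    exact (hbin a).2 (AddSubgroup.subset_closure ha)
  exact (hbin a).1 (hle (binomial_mem_latticeIdeal ha))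

end Closure

/-! ### Complete intersections -/

section Main

variable {K : Type*} [Field K] {s : ℕ} {ω : Fin s → ℕ} {𝓛 : AddSubgroup (Fin s → ℤ)}

lemma latticeIdeal_eq_span_image : latticeIdeal K 𝓛 = Ideal.span (binomial K '' 𝓛) := by
  rw [latticeIdeal]
  congr 1
  ext f
  simp only [Set.mem_ofPred_eq, Set.mem_image, SetLike.mem_coe, eq_comm]

lemma height_latticeIdeal (h𝓛 : IsHomogeneousLattice ω 𝓛)
    (hV : ∀ i, zeroLocus K (latticeIdeal K 𝓛 ⊔ Ideal.span {X i}) = ({0} : Set (Fin s → K))) :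
    (latticeIdeal K 𝓛).height = (s - 1 : ℕ) := by
  rcases Nat.eq_zero_or_pos s with rfl | hs
  · have : latticeIdeal K 𝓛 = ⊥ := by
      rw [eq_bot_iff, latticeIdeal, Ideal.span_le]
      rintro _ ⟨a, -, rfl⟩
      simp [binomial, Subsingleton.elim a 0]
    rw [this, Ideal.height_bot]
    rfl
  · refine le_antisymm (height_latticeIdeal_le h𝓛 ⟨0, hs⟩)
      (le_height_latticeIdeal h𝓛 (fun i A hA hi => ?_) ⟨0, hs⟩)
    refine exists_support_of_zeroLocus_eq (K := K) (G := 𝓛) (i := i) ?_ hA hi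
    rw [Ideal.span_union, ← latticeIdeal_eq_span_image]
    exact (hV i).subset

end Main

end LatticeIdeal

open LatticeIdeal in
theorem theorem2 (K : Type*) [Field K] (s : ℕ) (ω : Fin s → ℕ) (𝓛 : AddSubgroup (Fin s → ℤ))
    (h𝓛 : IsHomogeneousLattice ω 𝓛)
    (hV : ∀ i, zeroLocus K (latticeIdeal K 𝓛 ⊔ Ideal.span {X i}) = ({0} : Set (Fin s → K))) :
    (IsCompleteIntersection (latticeIdeal K 𝓛) ↔
      ∃ (h : Fin (s - 1) → MvPolynomial (Fin s) K) (a : Fin (s - 1) → Fin s → ℤ),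
        IsAdmissible ω 𝓛 h a) ∧
    (∀ (h : Fin (s - 1) → MvPolynomial (Fin s) K) (a : Fin (s - 1) → Fin s → ℤ),
      IsAdmissible ω 𝓛 h a → Ideal.span (Set.range h) = latticeIdeal K 𝓛) := by
  refine ⟨⟨?_, ?_⟩, fun h a H => span_eq_latticeIdeal_of_isAdmissible h𝓛 H⟩
  · rintro ⟨r, g, hr, hg⟩
    rw [height_latticeIdeal h𝓛 hV, Nat.cast_inj] at hr
    obtain ⟨b, hb, hspan⟩ := exists_generators_mem h𝓛.1 (G := binomial K '' 𝓛)
      (by rintro _ ⟨a, ha, rfl⟩; exact ⟨_, isWeightedHomogeneous_binomial h𝓛 ha⟩)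
      latticeIdeal_eq_span_image.symm ⟨0, zero_mem _, by simp [binomial]⟩ g hg.symm hr.symm.le
    choose a ha hab using hb
    obtain rfl : (fun j => binomial K (a j)) = b := funext hab
    refine ⟨_, a, ?_, fun j => ⟨_, isWeightedHomogeneous_binomial h𝓛 (ha j)⟩, fun j => rfl, ?_,
      fun i => ?_⟩
    · exact fun j => binomial_mem_latticeIdeal (ha j)
    · refine closure_eq_of_span_eq (K := K) (Set.range_subset_iff.2 ha) ?_
      rw [← Set.range_comp]
      exact hspan
    · rw [Ideal.span_union, hspan, hV]
  · rintro ⟨h, a, H⟩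
    exact ⟨s - 1, h, height_latticeIdeal h𝓛 hV, (span_eq_latticeIdeal_of_isAdmissible h𝓛 H).symm⟩
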